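/- Let $G$ be a countable discrete group with subgroups $H, K, L$ such that $H\subseteq K\cap L$, $H\neq K$, $H\neq L$ and $[G:H]<\infty$. For a subgroup $M$ of $G$ let $C^*_r(M)$ (resp. $C^*(M)$) be the reduced (resp. universal) group $C^*$-algebra, i.e. the completion of $\mathbb{C}[M]$ in the norm of the left regular representation on $\ell^2(M)$ (resp. in the norm $\sup_\pi\|\pi(\cdot)\|$ over all unitary representations $\pi$ of $M$). For $M\in\{H,K,L\}$ there is an injective unital $*$-homomorphism $C^*_r(M)\to C^*_r(G)$ (resp. $C^*(M)\to C^*(G)$) that sends $m\mapsto m$ for all $m\in M$. Write $B, C, D\subseteq A:=C^*_r(G)$ (resp. $A:=C^*(G)$) for the images belonging to $H, K, L$. There is a conditional expectation $E:A\to B$ with $E(g)=g$ for $g\in H$ and $E(g)=0$ for $g\in G\setminus H$. It has finite index, i.e. there is a finite quasi-basis $\lambda_1,\dots,\lambda_n\in A$ with $x=\sum_i E(x\lambda_i)\lambda_i^*=\sum_i\lambda_iE(\lambda_i^*x)$ for all $x\in A$. Moreover $C, D\in \mathrm{IMS}(B,A,E)\setminus\{B\}$, where $\mathrm{IMS}(B,A,E)$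 is the set of $C^*$-algebras $B\subseteq C\subseteq A$ for which there is a conditional expectation $F:A\to C$ with $E=E_{\restriction_C}\circ F$; and the interior angle $\alpha(C,D)$ with respect to $E$ satisfies $$\cos(\alpha(C,D))=\frac{[K\cap L:H]-1}{\sqrt{[K:H]-1}\,\sqrt{[L:H]-1}}.$$ Here $\alpha(C,D)\in[0,\frac{\pi}{2}]$ is defined by $$\cos(\alpha(C,D))=\frac{\|\langle e_C-e_B,\,e_D-e_B\rangle_A\|}{\|e_C-e_B\|_{A_1}\,\|e_D-e_B\|_{A_1}},$$ where $A$ is regarded as a Hilbert $B$-module with $\langle x,y\rangle_B=E(x^*y)$; $e_B$ and $e_C$ are the Jones projections $x\mapsto E(x)$ and $x\mapsto F(x)$ on $A$ (likewise $e_D$); $A_1=\mathrm{span}\{xe_By: x,y\in A\}$ is the $C^*$-basic construction; $E_1:A_1\to A$ is the dual conditional expectation, $E_1(xe_By)=\mathrm{Ind}(E)^{-1}xy$ with $\mathrm{Ind}(E)=\sum_i\lambda_i\lambda_i^*$; and $\langle X,Y\rangle_A=E_1(X^*Y)$, $\|X\|_{A_1}=\|E_1(X^*X)\|^{1/2}$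 for $X,Y\in A_1$. -/

import Mathlib

open scoped ENNReal

/-! ## Conditional expectations, quasi-bases, index -/

/-- A conditional expectation from the unital C*-algebra `A` onto its subalgebra `B`, regarded as a
map `A → A` with values in `B`: a positive contractive linear `B`-bimodule map fixing `B`.
Positivity is expressed by the fact that the positive elements are those of the form `b⋆ b`. -/
structure CondExp {A : Type*} [CStarAlgebra A] (B : StarSubalgebra ℂ A) where
  toLinearMap : A →ₗ[ℂ] A
  mem' : ∀ a, toLinearMap a ∈ B
  fix' : ∀ b ∈ B, toLinearMap b = b
  bimod' : ∀ b ∈ B, ∀ c ∈ B, ∀ a, toLinearMap (b * a * c) = b * toLinearMap a * c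
  pos' : ∀ a, ∃ b, toLinearMap (star a * a) = star b * b
  contr' : ∀ a, ‖toLinearMap a‖ ≤ ‖a‖

namespace CondExp

section General

variable {A : Type*} [CStarAlgebra A] {B C D : StarSubalgebra ℂ A}

noncomputable instance : CoeFun (CondExp B) (fun _ => A → A) := ⟨fun E => E.toLinearMap⟩

theorem mem (E : CondExp B) (a : A) : E a ∈ B := E.mem' a

theorem fix (E : CondExp B) {b : A} (hb : b ∈ B) : E b = b := E.fix' b hb

theorem map_left (E : CondExp B) {b : A} (hb : b ∈ B) (a : A) : E (b * a) = b * E a := by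
  simpa using E.bimod' b hb 1 (one_mem B) a

theorem map_right (E : CondExp B) {b : A} (hb : b ∈ B) (a : A) : E (a * b) = E a * b := by
  simpa using E.bimod' 1 (one_mem B) b hb a

theorem map_star (E : CondExp B) (a : A) : E (star a) = star (E a) := by
  have key : ∀ x : A, star (E (star x * x)) = E (star x * x) := by
    intro x
    obtain ⟨b, hb⟩ := E.pos' x
    rw [hb]; simp
  have h0 := key a
  have h1 := key (a + 1)
  have h2 := key (a + Complex.I • (1 : A))
  have hone : E (1 : A) = 1 := E.fix (one_mem B)
  simp only [star_add, star_smul, star_one, add_mul, mul_add, one_mul, mul_one, smul_mul_assoc,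
    mul_smul_comm, map_add, map_smul, hone, h0] at h1 h2
  simp only [RCLike.star_def, Complex.conj_I, neg_smul, star_neg] at h1 h2
  have e1 : star (E a) + star (E (star a)) = E a + E (star a) := by
    have := h1
    rw [← sub_eq_zero] at this ⊢
    rw [← this]; abel
  have e2 : Complex.I • star (E a) - Complex.I • star (E (star a))
      = Complex.I • E (star a) - Complex.I • E a := by
    have := h2
    rw [← sub_eq_zero] at this ⊢
    rw [← this]
    simp only [smul_add, smul_neg]
    abel
  have e3 : star (E a) - star (E (star a)) = E (star a) - E a := by
    have := congrArg (fun z => (-Complex.I) • z) e2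
    simpa [smul_sub, smul_smul] using this
  have e4 : (2 : ℂ) • star (E a) = (2 : ℂ) • E (star a) := by
    rw [two_smul, two_smul]
    have := congrArg₂ (· + ·) e1 e3
    calc star (E a) + star (E a)
        = star (E a) + star (E (star a)) + (star (E a) - star (E (star a))) := by abel
      _ = E a + E (star a) + (E (star a) - E a) := this
      _ = _ := by abel
  exact ((smul_right_injective A (two_ne_zero (α := ℂ))) e4).symm

/-- `l` is a quasi-basis for `E`. -/
def IsQuasiBasis (E : CondExp B) {n : ℕ} (l : Fin n → A) : Prop :=
  ∀ x : A, x = ∑ i, E (x * l i) * star (l i) ∧ x = ∑ i, l i * E (star (l i) * x)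

/-- `E` has finite index if it admits a finite quasi-basis. -/
def FiniteIndex (E : CondExp B) : Prop :=
  ∃ (n : ℕ) (l : Fin n → A), E.IsQuasiBasis l

theorem sum_mul_star_eq (E : CondExp B) {n m : ℕ} {l : Fin n → A} {k : Fin m → A}
    (hl : E.IsQuasiBasis l) (hk : E.IsQuasiBasis k) :
    ∑ i, l i * star (l i) = ∑ j, k j * star (k j) := by
  calc ∑ i, l i * star (l i)
      = ∑ i, ∑ j, l i * (E (star (l i) * k j) * star (k j)) := by
        refine Finset.sum_congr rfl fun i _ => ?_
        rw [← Finset.mul_sum, ← (hk (star (l i))).1]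
    _ = ∑ j, (∑ i, l i * E (star (l i) * k j)) * star (k j) := by
        rw [Finset.sum_comm]
        refine Finset.sum_congr rfl fun j _ => ?_
        rw [Finset.sum_mul]
        exact Finset.sum_congr rfl fun i _ => (mul_assoc _ _ _).symm
    _ = _ := by
        refine Finset.sum_congr rfl fun j _ => ?_
        rw [← (hl (k j)).2]

open Classical in
/-- The Watatani index `∑ λᵢ λᵢ⋆` of a conditional expectation of finite index; it does not depend
on the quasi-basis, see `CondExp.index_eq`. -/
noncomputable def index (E : CondExp B) : A :=
  if h : E.FiniteIndex then ∑ i, h.choose_spec.choose i * star (h.choose_spec.choose i) else 0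

theorem index_eq (E : CondExp B) {n : ℕ} {l : Fin n → A} (hl : E.IsQuasiBasis l) :
    E.index = ∑ i, l i * star (l i) := by
  have h : E.FiniteIndex := ⟨n, l, hl⟩
  rw [index, dif_pos h]
  exact E.sum_mul_star_eq h.choose_spec.choose_spec hl

/-- `E` is nondegenerate: a finite index conditional expectation detects zero. -/
theorem eq_zero_of_finiteIndex (E : CondExp B) (hE : E.FiniteIndex) {x : A}
    (hx : ∀ z, E (star z * x) = 0) : x = 0 := by
  obtain ⟨n, l, hl⟩ := hE
  rw [(hl x).2]
  exact Finset.sum_eq_zero fun i _ => by rw [hx, mul_zero]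

/-! ## Intermediate subalgebras -/

/-- `F : A → C` is compatible with `E : A → B`, that is `E = E|_C ∘ F`. -/
def Compatible (E : CondExp B) (F : CondExp C) : Prop := ∀ a, E a = E (F a)

/-- `IMS(B, A, E)`: the intermediate C*-subalgebras `B ⊆ C ⊆ A` which admit a conditional
expectation `F : A → C` compatible with `E`. -/
def IMS (E : CondExp B) : Set (StarSubalgebra ℂ A) :=
  {C | IsClosed (C : Set A) ∧ B ≤ C ∧ ∃ F : CondExp C, E.Compatible F}

/-- The compatible conditional expectation onto a member of `IMS(B, A, E)`. -/
noncomputable def compat (E : CondExp B) (hC : C ∈ E.IMS) : CondExp C := hC.2.2.choose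

theorem compat_compatible (E : CondExp B) (hC : C ∈ E.IMS) : E.Compatible (E.compat hC) :=
  hC.2.2.choose_spec

/-- The compatible conditional expectation is unique. -/
theorem compatible_unique (E : CondExp B) (hE : E.FiniteIndex) {F F' : CondExp C}
    (hF : E.Compatible F) (hF' : E.Compatible F') (a : A) : F a = F' a := by
  rw [← sub_eq_zero]
  have key : ∀ z ∈ C, E (z * (F a - F' a)) = 0 := by
    intro z hz
    rw [mul_sub, map_sub, ← F.map_left hz, ← F'.map_left hz, ← hF, ← hF', sub_self]
  refine E.eq_zero_of_finiteIndex hE fun z => ?_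
  rw [hF, F.map_right (sub_mem (F.mem a) (F'.mem a))]
  exact key _ (F.mem _)

/-! ## The basic construction

Let `E : A → B` be of finite index. Then `A` itself is a (complete) Hilbert `B`-module for the
`B`-valued inner product `⟨x, y⟩ = E (x⋆ y)`. -/

/-- `S` is an adjoint of `T` for the `B`-valued inner product `⟨x, y⟩ = E (x⋆ y)` on `A`. -/
def IsAdjointPair (E : CondExp B) (T S : Module.End ℂ A) : Prop :=
  ∀ x y, E (star (T x) * y) = E (star x * S y)

theorem IsAdjointPair.symm {E : CondExp B} {T S : Module.End ℂ A} (h : E.IsAdjointPair T S) :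
    E.IsAdjointPair S T := by
  intro x y
  have := congrArg star (h y x)
  rw [← E.map_star, ← E.map_star] at this
  simpa using this.symm

theorem IsAdjointPair.unique {E : CondExp B} (hE : E.FiniteIndex) {T S S' : Module.End ℂ A}
    (h : E.IsAdjointPair T S) (h' : E.IsAdjointPair T S') : S = S' := by
  ext y
  rw [← sub_eq_zero]
  refine E.eq_zero_of_finiteIndex hE fun z => ?_
  rw [mul_sub, map_sub, ← h, ← h', sub_self]

/-- The algebra `𝓛_B(A)` of adjointable operators on the Hilbert `B`-module `A`. -/
noncomputable def adjointable (E : CondExp B) : Subalgebra ℂ (Module.End ℂ A) where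
  carrier := {T | ∃ S, E.IsAdjointPair T S}
  mul_mem' := by
    rintro T T' ⟨S, hS⟩ ⟨S', hS'⟩
    exact ⟨S' * S, fun x y => by
      rw [Module.End.mul_apply, hS, hS', Module.End.mul_apply]⟩
  add_mem' := by
    rintro T T' ⟨S, hS⟩ ⟨S', hS'⟩
    exact ⟨S + S', fun x y => by
      simp only [LinearMap.add_apply, star_add, add_mul, mul_add, map_add, hS x y, hS' x y]⟩
  algebraMap_mem' c := ⟨algebraMap ℂ _ (star c), fun x y => by
    simp [Module.algebraMap_end_apply]⟩

/-- The adjoint `T⋆` in `𝓛_B(A)` (unique by `CondExp.IsAdjointPair.unique`). -/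
noncomputable def adj (E : CondExp B) (T : E.adjointable) : E.adjointable :=
  ⟨T.2.choose, T.1, T.2.choose_spec.symm⟩

theorem adj_spec (E : CondExp B) (T : E.adjointable) : E.IsAdjointPair T.1 (E.adj T).1 :=
  T.2.choose_spec

/-- The embedding of `A` in `𝓛_B(A)` by left multiplication. -/
noncomputable def leftMul (E : CondExp B) : A →ₐ[ℂ] E.adjointable :=
  (Algebra.lmul ℂ A).codRestrict E.adjointable fun a => ⟨Algebra.lmul ℂ A (star a), fun x y => by
    simp [mul_assoc]⟩

theorem leftMul_apply (E : CondExp B) (a x : A) : (E.leftMul a).1 x = a * x := rfl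

/-- The Jones projection `e_C ∈ 𝓛_C(A) ⊆ 𝓛_B(A)` of a conditional expectation `F : A → C` that is
compatible with `E`: it is the operator `x ↦ F x` on `A`. -/
noncomputable def jones (E : CondExp B) (F : CondExp C) (hF : E.Compatible F) : E.adjointable :=
  ⟨F.toLinearMap, F.toLinearMap, fun x y => by
    rw [hF, ← F.map_star, F.map_left (F.mem _), hF (star x * F y), F.map_right (F.mem _)]⟩

theorem jones_apply (E : CondExp B) (F : CondExp C) (hF : E.Compatible F) (x : A) :
    (E.jones F hF).1 x = F x := rfl

theorem compatible_self (E : CondExp B) : E.Compatible E := fun a => (E.fix (E.mem a)).symm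

/-- The Jones projection `e_B` of `E`. -/
noncomputable def e (E : CondExp B) : E.adjointable := E.jones E E.compatible_self

/-- The basic construction `A₁ = span {x e_B y : x, y ∈ A} ⊆ 𝓛_B(A)` of `B ⊆ A` with respect to a
conditional expectation `E` of finite index (for finite index this span is already closed). -/
noncomputable def basic (E : CondExp B) : Submodule ℂ E.adjointable :=
  Submodule.span ℂ (Set.range fun p : A × A => E.leftMul p.1 * E.e * E.leftMul p.2)

/-- Adjointable operators are `B`-linear. -/
theorem adjointable_map_mul (E : CondExp B) (hE : E.FiniteIndex) (T : E.adjointable) (x : A)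
    {b : A} (hb : b ∈ B) : T.1 (x * b) = T.1 x * b := by
  rw [← sub_eq_zero]
  refine E.eq_zero_of_finiteIndex hE fun z => ?_
  have h := (E.adj_spec T).symm
  rw [mul_sub, map_sub, ← h, ← mul_assoc, ← mul_assoc, E.map_right hb, E.map_right hb, ← h,
    sub_self]

theorem mul_mem_basic (E : CondExp B) (hE : E.FiniteIndex) (T : E.adjointable) {X : E.adjointable}
    (hX : X ∈ E.basic) : T * X ∈ E.basic := by
  induction hX using Submodule.span_induction with
  | mem X hX =>
    obtain ⟨⟨x, y⟩, rfl⟩ := hX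
    refine Submodule.subset_span ⟨(T.1 x, y), ?_⟩
    refine Subtype.ext (LinearMap.ext fun z => ?_)
    exact (E.adjointable_map_mul hE T x (E.mem (y * z))).symm
  | zero => rw [mul_zero]; exact zero_mem _
  | add X Y _ _ hX hY => rw [mul_add]; exact add_mem hX hY
  | smul c X _ hX => rw [mul_smul_comm]; exact Submodule.smul_mem _ c hX

/-- `e_C ∈ A₁`. -/
theorem jones_mem_basic (E : CondExp B) (hE : E.FiniteIndex) (hBC : B ≤ C) (F : CondExp C)
    (hF : E.Compatible F) : E.jones F hF ∈ E.basic := by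
  obtain ⟨n, l, hl⟩ := hE
  have key : E.jones F hF = ∑ i, E.leftMul (F (l i)) * E.e * E.leftMul (star (F (l i))) := by
    refine Subtype.ext (LinearMap.ext fun x => ?_)
    have h1 : ∀ i, E (star (F (l i)) * x) = E (star (l i) * F x) := by
      intro i
      rw [hF, ← F.map_star, F.map_left (F.mem _), hF (star (l i) * F x), F.map_right (F.mem _)]
    have h2 : F x = ∑ i, F (l i) * E (star (l i) * F x) := by
      calc F x = F (F x) := (F.fix (F.mem x)).symm
        _ = F (∑ i, l i * E (star (l i) * F x)) := congrArg _ (hl (F x)).2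
        _ = _ := by
          rw [map_sum]
          exact Finset.sum_congr rfl fun i _ => F.map_right (hBC (E.mem _)) _
    rw [jones_apply, h2, AddSubmonoidClass.coe_finsetSum, LinearMap.sum_apply]
    exact Finset.sum_congr rfl fun i _ => congrArg _ (h1 i).symm
  rw [key]
  exact Submodule.sum_mem _ fun i _ => Submodule.subset_span ⟨(_, _), rfl⟩

theorem e_mem_basic (E : CondExp B) : E.e ∈ E.basic :=
  Submodule.subset_span ⟨(1, 1), by simp⟩

/-- The dual conditional expectation `E₁ : A₁ → A`, the linear map that is determined by
`E₁ (x e_B y) = Ind(E)⁻¹ x y`, see `CondExp.dual_apply`. -/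
noncomputable def dual (E : CondExp B) (hE : E.FiniteIndex) : E.basic →ₗ[ℂ] A where
  toFun T := Ring.inverse E.index *
    ∑ i, T.1.1 (hE.choose_spec.choose i) * star (hE.choose_spec.choose i)
  map_add' S T := by simp [add_mul, mul_add, Finset.sum_add_distrib]
  map_smul' c T := by simp [← Finset.smul_sum]

theorem dual_apply (E : CondExp B) (hE : E.FiniteIndex) (x y : A)
    (h : E.leftMul x * E.e * E.leftMul y ∈ E.basic) :
    E.dual hE ⟨E.leftMul x * E.e * E.leftMul y, h⟩ = Ring.inverse E.index * (x * y) := by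
  have hl := hE.choose_spec.choose_spec
  refine congrArg (Ring.inverse E.index * ·) ?_
  refine Eq.trans ?_ (congrArg (x * ·) (hl y).1.symm)
  rw [Finset.mul_sum]
  exact Finset.sum_congr rfl fun i _ => mul_assoc _ _ _

/-! ## The interior angle -/

/-- The `A`-valued inner product `⟨X, Y⟩_A = E₁ (X⋆ Y)` on `A₁`. -/
noncomputable def innerBasic (E : CondExp B) (hE : E.FiniteIndex) (X Y : E.basic) : A :=
  E.dual hE ⟨E.adj X.1 * Y.1, E.mul_mem_basic hE _ Y.2⟩

/-- The norm `‖X‖_{A₁} = ‖E₁ (X⋆ X)‖ ^ (1/2)` on `A₁`. -/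
noncomputable def normBasic (E : CondExp B) (hE : E.FiniteIndex) (X : E.basic) : ℝ :=
  Real.sqrt ‖E.innerBasic hE X X‖

/-- The element `e_C - e_B` of `A₁`, for `C ∈ IMS(B, A, E)`. -/
noncomputable def jonesDiff (E : CondExp B) (hE : E.FiniteIndex) (hC : C ∈ E.IMS) : E.basic :=
  ⟨E.jones (E.compat hC) (E.compat_compatible hC), E.jones_mem_basic hE hC.2.1 _ _⟩
    - ⟨E.e, E.e_mem_basic⟩

/-- The interior angle `α(C, D) ∈ [0, π/2]` between `C, D ∈ IMS(B, A, E) \ {B}`, with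
`cos α(C, D) = ‖⟨e_C - e_B, e_D - e_B⟩_A‖ / (‖e_C - e_B‖_{A₁} ‖e_D - e_B‖_{A₁})`. -/
noncomputable def interiorAngle (E : CondExp B) (hE : E.FiniteIndex)
    (hC : C ∈ E.IMS) (hD : D ∈ E.IMS) : ℝ :=
  Real.arccos (‖E.innerBasic hE (E.jonesDiff hE hC) (E.jonesDiff hE hD)‖ /
    (E.normBasic hE (E.jonesDiff hE hC) * E.normBasic hE (E.jonesDiff hE hD)))

end General

end CondExp

/-! ## The closed algebra generated by a unitary representation -/

/-- The C*-algebra generated by a homomorphism `u` from `G` to the unitary group of `𝓑`: the closed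
star subalgebra generated by `u(G)`, which is the closure of the linear span of `u(G)`. -/
noncomputable def generatedCStar {G 𝓑 : Type*} [Group G] [CStarAlgebra 𝓑] (u : G →* unitary 𝓑) :
    StarSubalgebra ℂ 𝓑 :=
  (StarAlgebra.adjoin ℂ (Set.range fun g => (u g : 𝓑))).topologicalClosure

theorem mem_generatedCStar {G 𝓑 : Type*} [Group G] [CStarAlgebra 𝓑] (u : G →* unitary 𝓑) (g : G) :
    (u g : 𝓑) ∈ generatedCStar u :=
  StarSubalgebra.le_topologicalClosure _ (StarAlgebra.subset_adjoin ℂ _ ⟨g, rfl⟩)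

/-! ## The reduced group C*-algebra -/

section Reduced

variable (G : Type*) [Group G]

/-- The Hilbert space `ℓ²(G)`. -/
abbrev L2 : Type _ := lp (fun _ : G => ℂ) 2

variable {G}

theorem memℓp_leftTranslate (g : G) (f : L2 G) : Memℓp (fun x => f (g⁻¹ * x)) 2 :=
  memℓp_gen ((Equiv.mulLeft g⁻¹).summable_iff.2 ((lp.memℓp f).summable (by simp)))

/-- Left translation `(λ_g f)(x) = f (g⁻¹ x)` on `ℓ²(G)`, as a linear map. -/
noncomputable def leftTranslateₗ (g : G) : L2 G →ₗ[ℂ] L2 G where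
  toFun f := ⟨fun x => f (g⁻¹ * x), memℓp_leftTranslate g f⟩
  map_add' _ _ := rfl
  map_smul' _ _ := rfl

theorem norm_leftTranslateₗ (g : G) (f : L2 G) : ‖leftTranslateₗ g f‖ = ‖f‖ := by
  have h2 : 0 < (2 : ℝ≥0∞).toReal := by simp
  rw [lp.norm_eq_tsum_rpow h2, lp.norm_eq_tsum_rpow h2]
  exact congrArg (· ^ (1 / (2 : ℝ≥0∞).toReal))
    ((Equiv.mulLeft g⁻¹).tsum_eq fun x => ‖f x‖ ^ (2 : ℝ≥0∞).toReal)

/-- Left translation on `ℓ²(G)`, as a surjective isometry. -/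
noncomputable def leftTranslate (g : G) : L2 G ≃ₗᵢ[ℂ] L2 G where
  toLinearEquiv := LinearEquiv.ofLinearMap (leftTranslateₗ g) (leftTranslateₗ g⁻¹)
    (LinearMap.ext fun f => lp.ext (funext fun x => congrArg f (by simp)))
    (LinearMap.ext fun f => lp.ext (funext fun x => congrArg f (by simp)))
  norm_map' f := norm_leftTranslateₗ g f

theorem leftTranslate_apply (g : G) (f : L2 G) (x : G) : leftTranslate g f x = f (g⁻¹ * x) := rfl

variable (G)

/-- The left regular representation of `G` on `ℓ²(G)`. -/
noncomputable def leftRegular : G →* unitary (L2 G →L[ℂ] L2 G) :=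
  (Unitary.linearIsometryEquiv (𝕜 := ℂ) (H := L2 G)).symm.toMonoidHom.comp
    { toFun := leftTranslate
      map_one' := by ext f x; simp [leftTranslate_apply]
      map_mul' := fun g h => by ext f x; simp [leftTranslate_apply, mul_assoc] }

theorem leftRegular_apply (g : G) (f : L2 G) (x : G) :
    (leftRegular G g : L2 G →L[ℂ] L2 G) f x = f (g⁻¹ * x) := rfl

/-- The reduced group C*-algebra `C*_r(G)`: the completion of `ℂ[G]` in the norm of
`B(ℓ²(G))`, that is the closure of the image of `ℂ[G]` under the left regular representation. -/
def ReducedGroupCStar : Type _ := generatedCStar (leftRegular G)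

noncomputable instance : CStarAlgebra (ReducedGroupCStar G) :=
  StarSubalgebra.cstarAlgebra (generatedCStar (leftRegular G))
    (h_closed := StarSubalgebra.isClosed_topologicalClosure _)

variable {G}

/-- The inclusion `C*_r(G) ⊆ B(ℓ²(G))`. -/
noncomputable def ReducedGroupCStar.incl : ReducedGroupCStar G →⋆ₐ[ℂ] (L2 G →L[ℂ] L2 G) :=
  (generatedCStar (leftRegular G)).subtype

theorem ReducedGroupCStar.norm_incl (x : ReducedGroupCStar G) : ‖incl x‖ = ‖x‖ := rfl

/-- The canonical unitary of `C*_r(G)` given by `g ∈ G`. -/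
noncomputable def ReducedGroupCStar.of (g : G) : ReducedGroupCStar G :=
  ⟨leftRegular G g, mem_generatedCStar _ g⟩

end Reduced

/-! ## The universal group C*-algebra -/

/-- A unitary representation of `G` on a nonzero Hilbert space. The universe of `G` suffices: it
contains, up to equivalence, all cyclic representations. -/
structure UnitaryRep.{u} (G : Type u) [Group G] where
  space : Type u
  [normedAddCommGroup : NormedAddCommGroup space]
  [innerProductSpace : InnerProductSpace ℂ space]
  [completeSpace : CompleteSpace space]
  [nontrivial : Nontrivial space]
  rep : G →* unitary (space →L[ℂ] space)

section Universal

universe u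

variable (G : Type u) [Group G]

namespace UnitaryRep

attribute [instance] normedAddCommGroup innerProductSpace completeSpace nontrivial

/-- The C*-algebra of bounded families of operators `(T_π)` indexed by the unitary representations
`π` of `G`, where `T_π` acts on the space of `π`; its norm is `sup_π ‖T_π‖`. -/
abbrev BoundedFamilies : Type (u + 1) :=
  lp (fun ρ : UnitaryRep G => ρ.space →L[ℂ] ρ.space) ∞

noncomputable instance : CStarAlgebra (BoundedFamilies G) where

variable {G} in
theorem memℓp_rep (g : G) :
    Memℓp (fun ρ : UnitaryRep G => (ρ.rep g : ρ.space →L[ℂ] ρ.space)) ∞ :=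
  memℓp_infty ⟨1, by
    rintro _ ⟨ρ, rfl⟩
    exact (CStarRing.norm_coe_unitary _).le⟩

/-- The homomorphism `g ↦ (π(g))_π`. -/
noncomputable def univ : G →* unitary (BoundedFamilies G) where
  toFun g := ⟨⟨fun ρ => (ρ.rep g : ρ.space →L[ℂ] ρ.space), memℓp_rep g⟩,
    lp.ext (funext fun ρ => Unitary.star_mul_self_of_mem (ρ.rep g).2),
    lp.ext (funext fun ρ => Unitary.mul_star_self_of_mem (ρ.rep g).2)⟩
  map_one' := Subtype.ext (lp.ext (funext fun ρ => congrArg Subtype.val (map_one ρ.rep)))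
  map_mul' g h := Subtype.ext (lp.ext (funext fun ρ => congrArg Subtype.val (map_mul ρ.rep g h)))

end UnitaryRep

/-- The universal group C*-algebra `C*(G)`: the completion of `ℂ[G]` in the universal norm
`‖x‖_u = sup_π ‖π(x)‖`, that is the closure of the image of `ℂ[G]` under `x ↦ (π(x))_π`. -/
def GroupCStar : Type (u + 1) := generatedCStar (UnitaryRep.univ G)

noncomputable instance : CStarAlgebra (GroupCStar G) :=
  StarSubalgebra.cstarAlgebra (generatedCStar (UnitaryRep.univ G))
    (h_closed := StarSubalgebra.isClosed_topologicalClosure _)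

variable {G}

/-- The inclusion of `C*(G)` in the bounded families of operators. -/
noncomputable def GroupCStar.incl : GroupCStar G →⋆ₐ[ℂ] UnitaryRep.BoundedFamilies G :=
  (generatedCStar (UnitaryRep.univ G)).subtype

theorem GroupCStar.norm_incl (x : GroupCStar G) : ‖incl x‖ = ‖x‖ := rfl

/-- The canonical unitary of `C*(G)` given by `g ∈ G`. -/
noncomputable def GroupCStar.of (g : G) : GroupCStar G :=
  ⟨UnitaryRep.univ G g, mem_generatedCStar _ g⟩

/-- The norm of a finite sum `∑ a_g g` in `C*(G)` is its universal norm. -/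
theorem GroupCStar.norm_sum (s : Finset G) (a : G → ℂ) :
    ‖∑ g ∈ s, a g • GroupCStar.of g‖ =
      ⨆ ρ : UnitaryRep G, ‖∑ g ∈ s, a g • (ρ.rep g : ρ.space →L[ℂ] ρ.space)‖ := by
  have h : GroupCStar.incl (∑ g ∈ s, a g • GroupCStar.of g)
      = ∑ g ∈ s, a g • ((UnitaryRep.univ G g : unitary _) : UnitaryRep.BoundedFamilies G) := by
    rw [map_sum]
    exact Finset.sum_congr rfl fun g _ => map_smul GroupCStar.incl (a g) (GroupCStar.of g)
  rw [← norm_incl, h, lp.norm_eq_ciSup]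
  refine iSup_congr fun ρ => congrArg _ ?_
  rw [lp.coeFn_sum, Finset.sum_apply]
  rfl

end Universal

/-! ### Density arguments and coset sums -/

section Generalities

/-! Both cases follow from one piece of data, a `SubgroupRetract`: for each of the three subgroups
`M`, a star homomorphism extending `ℂ[M] ⊆ ℂ[G]` and a linear contraction backwards extending the
coordinate projection `ℂ[G] → ℂ[M]`. The group unitaries have dense span, so identities between
continuous linear maps need checking only on them. The contraction is a left inverse of the
homomorphism, which is therefore injective; the range is the fixed-point set of the composite
`proj`, hence closed. The map `proj` is the conditional expectation. Its positivity comes from the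
finite coset expansion `a = ∑ u_c E(u_c⋆ a)`, which also says that coset representatives form a
quasi-basis; the index is thus the scalar `[G:H]`.

The angle is then a count (`norm_innerBasic_jonesDiff`). All expectations multiply `u g` by the
indicator of a subgroup, so `(e_C - e_B)(e_D - e_B)` multiplies it by the indicator of `K ∩ L` minus
that of `H`. Summing over cosets and dividing by the index gives the scalar `([K ∩ L : H] -
1)/[G:H]`. Taking `C = D` gives the squared norms, and `[G:H]` cancels in the cosine.

It remains to build the retracts. In the reduced case (`leftRegularRetract`), `ℓ²(G)` is a finite
sum of copies of `ℓ²(M)`: operators on `ℓ²(M)` are amplified, operators on `ℓ²(G)` compressed. In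
the universal case (`univRetract`), restriction of representations gives the homomorphism, and
induction followed by compression to the trivial coset gives the contraction. -/

/-- The linear map `T` restricts to the canonical projection `ℂ[G] → ℂ[M]` on the linear span of
the unitaries `u g`. -/
def RestrictsTo {G A : Type*} [Group G] [CStarAlgebra A] (u : G →* unitary A) (M : Subgroup G)
    (T : A →ₗ[ℂ] A) : Prop :=
  (∀ g ∈ M, T (u g) = u g) ∧ ∀ g ∉ M, T (u g) = 0

theorem RestrictsTo.apply {G A : Type*} [Group G] [CStarAlgebra A] {u : G →* unitary A}
    {M : Subgroup G} {T : A →ₗ[ℂ] A} (hT : RestrictsTo u M T) (g : G) [Decidable (g ∈ M)] :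
    T (u g) = if g ∈ M then (u g : A) else 0 := by
  split_ifs with h
  exacts [hT.1 g h, hT.2 g h]

/-- Two bounded linear maps that agree on a set with dense span are equal. -/
theorem LinearMap.eq_of_dense_span {V W : Type*} [NormedAddCommGroup V] [NormedSpace ℂ V]
    [NormedAddCommGroup W] [NormedSpace ℂ W] {s : Set V}
    (hs : Dense (Submodule.span ℂ s : Set V)) {S T : V →ₗ[ℂ] W} (hS : Continuous S)
    (hT : Continuous T) (h : ∀ x ∈ s, S x = T x) (x : V) : S x = T x :=
  DFunLike.congr_fun (ContinuousLinearMap.ext_on (f := ⟨S, hS⟩) (g := ⟨T, hT⟩) hs h) x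

theorem LinearMap.continuous_of_contractive {V W : Type*} [NormedAddCommGroup V] [NormedSpace ℂ V]
    [NormedAddCommGroup W] [NormedSpace ℂ W] {T : V →ₗ[ℂ] W} (hT : ∀ x, ‖T x‖ ≤ ‖x‖) :
    Continuous T :=
  AddMonoidHomClass.continuous_of_bound T 1 fun x => by simpa using hT x

variable {G : Type*} [Group G]

theorem coe_unitary_mul {A : Type*} [CStarAlgebra A] (u : G →* unitary A) (g h : G) :
    (u (g * h) : A) = u g * u h := by
  rw [map_mul]; rfl

theorem coe_unitary_inv {A : Type*} [CStarAlgebra A] (u : G →* unitary A) (g : G) :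
    (u g⁻¹ : A) = star (u g : A) := by
  rw [map_inv]; rfl

theorem sum_quotient_out_ite {V : Type*} [AddCommMonoid V] (H : Subgroup G) [Fintype (G ⧸ H)]
    [DecidablePred (· ∈ H)] (g : G) (a : G ⧸ H → V) :
    ∑ c : G ⧸ H, (if c.out⁻¹ * g ∈ H then a c else 0) = a g := by
  classical
  have h : ∀ c : G ⧸ H, c.out⁻¹ * g ∈ H ↔ c = g := fun c => by
    rw [← QuotientGroup.eq, QuotientGroup.out_eq']
  simp [h]

/-- Since `M` is a union of left cosets of `H`, whether a representative lies in `M` does not depend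
on its choice; the cosets counted are those in the image of `M/H`. -/
theorem card_quotient_out_mem {H M : Subgroup G} (hHM : H ≤ M) [Fintype (G ⧸ H)]
    [DecidablePred (· ∈ M)] :
    (Finset.univ.filter fun c : G ⧸ H => c.out ∈ M).card = H.relIndex M := by
  classical
  have hmem : ∀ c : G ⧸ H, ∀ g : G, c = g → (c.out ∈ M ↔ g ∈ M) := by
    intro c g hc
    have h : c.out⁻¹ * g ∈ M := hHM (by rw [← QuotientGroup.eq, QuotientGroup.out_eq', hc])
    exact ⟨fun hx => by simpa using mul_mem hx h, fun hx => by
      simpa using mul_mem hx (inv_mem h)⟩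
  let f : M ⧸ H.subgroupOf M → G ⧸ H := Quotient.map' Subtype.val fun a b h => by
    rw [QuotientGroup.leftRel_apply] at h ⊢
    exact h
  have hf : Function.Injective f := by
    rintro ⟨a⟩ ⟨b⟩ h
    have h' : ((a : G) : G ⧸ H) = (b : G) := h
    rw [QuotientGroup.eq] at h'
    exact QuotientGroup.eq.2 h'
  have himage : Set.range f = {c : G ⧸ H | c.out ∈ M} := by
    ext c
    constructor
    · rintro ⟨⟨a⟩, rfl⟩
      exact (hmem _ a rfl).2 a.2
    · intro hc
      exact ⟨QuotientGroup.mk ⟨c.out, hc⟩, QuotientGroup.out_eq' c⟩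
  rw [Subgroup.relIndex, Subgroup.index, ← Nat.card_range_of_injective hf, himage,
    Nat.card_coe_set_eq, ← Set.ncard_coe_finset, Finset.coe_filter_univ]

theorem relIndex_ne_zero_of_finiteIndex (H M : Subgroup G) [H.FiniteIndex] : H.relIndex M ≠ 0 :=
  Subgroup.FiniteIndex.index_ne_zero (H := H.subgroupOf M)

variable {A : Type*} [CStarAlgebra A] {u : G →* unitary A} {H : Subgroup G} [Fintype (G ⧸ H)]
  {T : A →ₗ[ℂ] A}

theorem RestrictsTo.sum_apply_mul_out (hT : RestrictsTo u H T)
    (hu : Dense (Submodule.span ℂ (Set.range fun g => (u g : A)) : Set A)) (hc : Continuous T)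
    (x : A) : ∑ c : G ⧸ H, T (x * u c.out) * star (u c.out : A) = x := by
  classical
  have key := LinearMap.eq_of_dense_span hu (S := LinearMap.id)
    (T := ∑ c : G ⧸ H, (LinearMap.mulRight ℂ (star (u c.out : A))).comp
      (T.comp (LinearMap.mulRight ℂ (u c.out : A)))) continuous_id ?_ ?_ x
  · simpa using key.symm
  · simp only [LinearMap.coe_sum, LinearMap.coe_comp, Finset.sum_fn, Function.comp_def,
      LinearMap.mulRight_apply]
    fun_prop
  · rintro _ ⟨g, rfl⟩
    -- Only the coset of `g⁻¹` survives, and there the two factors `u c.out` cancel.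
    have h : ∀ c : G ⧸ H, T (u g * u c.out) * star (u c.out : A)
        = if c.out⁻¹ * g⁻¹ ∈ H then (u g : A) else 0 := fun c => by
      rw [← coe_unitary_mul, hT.apply, ← inv_mem_iff (x := g * c.out), mul_inv_rev, ite_mul,
        coe_unitary_mul, mul_assoc, Unitary.mul_star_self_of_mem (u _).2, mul_one, zero_mul]
    simp [h, sum_quotient_out_ite H g⁻¹ fun _ => (u g : A)]

theorem RestrictsTo.sum_out_mul_apply (hT : RestrictsTo u H T)
    (hu : Dense (Submodule.span ℂ (Set.range fun g => (u g : A)) : Set A)) (hc : Continuous T)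
    (x : A) : ∑ c : G ⧸ H, (u c.out : A) * T (star (u c.out : A) * x) = x := by
  classical
  have key := LinearMap.eq_of_dense_span hu (S := LinearMap.id)
    (T := ∑ c : G ⧸ H, (LinearMap.mulLeft ℂ (u c.out : A)).comp
      (T.comp (LinearMap.mulLeft ℂ (star (u c.out : A))))) continuous_id ?_ ?_ x
  · simpa using key.symm
  · simp only [LinearMap.coe_sum, LinearMap.coe_comp, Finset.sum_fn, Function.comp_def,
      LinearMap.mulLeft_apply]
    fun_prop
  · rintro _ ⟨g, rfl⟩
    have h : ∀ c : G ⧸ H, (u c.out : A) * T (star (u c.out : A) * u g)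
        = if c.out⁻¹ * g ∈ H then (u g : A) else 0 := fun c => by
      rw [← coe_unitary_inv, ← coe_unitary_mul, hT.apply, mul_ite, mul_zero, ← coe_unitary_mul,
        mul_inv_cancel_left]
    simp [h, sum_quotient_out_ite H g fun _ => (u g : A)]

end Generalities

/-! ### Computing the inner product and the angle with coset representatives -/

namespace CondExp

variable {A : Type*} [CStarAlgebra A] {B C D : StarSubalgebra ℂ A}

theorem continuous (E : CondExp B) : Continuous E :=
  LinearMap.continuous_of_contractive (T := E.toLinearMap) E.contr'

/-- The dual conditional expectation may be computed with any quasi-basis. -/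
theorem dual_eq_of_isQuasiBasis (E : CondExp B) (hE : E.FiniteIndex) {n : ℕ} {l : Fin n → A}
    (hl : E.IsQuasiBasis l) (T : E.basic) :
    E.dual hE T = Ring.inverse E.index * ∑ i, T.1.1 (l i) * star (l i) := by
  have hk := hE.choose_spec.choose_spec
  refine congrArg (Ring.inverse E.index * ·) ?_
  set k := hE.choose_spec.choose
  -- As for the independence of the index, with `T` inserted: `k i` is expanded in the quasi-basis
  -- `l`, the coefficients leave `T` by `B`-linearity, and the sum over `i` reassembles `star (l
  -- j)`.
  calc ∑ i, T.1.1 (k i) * star (k i)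
      = ∑ i, ∑ j, T.1.1 (l j) * (E (star (l j) * k i) * star (k i)) := by
        refine Finset.sum_congr rfl fun i _ => ?_
        have h : T.1.1 (k i) = T.1.1 (∑ j, l j * E (star (l j) * k i)) :=
          congrArg _ (hl (k i)).2
        rw [h, map_sum, Finset.sum_mul]
        refine Finset.sum_congr rfl fun j _ => ?_
        rw [E.adjointable_map_mul hE _ _ (E.mem _), mul_assoc]
    _ = _ := by
        rw [Finset.sum_comm]
        refine Finset.sum_congr rfl fun j _ => ?_
        rw [← Finset.mul_sum, ← (hk (star (l j))).1]

/-- Both sides equal `E (star (F x) * F y)`: compatibility allows inserting `F` under `E`, and the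
factor already in `C` comes out of it. -/
theorem jones_isAdjointPair (E : CondExp B) (F : CondExp C) (hF : E.Compatible F) :
    E.IsAdjointPair (E.jones F hF).1 (E.jones F hF).1 := by
  intro x y
  rw [jones_apply, jones_apply, hF, ← F.map_star, F.map_left (F.mem _), hF (star x * F y),
    F.map_right (F.mem _)]

theorem jonesDiff_apply (E : CondExp B) (hE : E.FiniteIndex) (hC : C ∈ E.IMS) (x : A) :
    (E.jonesDiff hE hC).1.1 x = E.compat hC x - E x := rfl

/-- The operator `adj` is obtained by choice, so self-adjointness has to go through uniqueness of
adjoints. -/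
theorem adj_jonesDiff (E : CondExp B) (hE : E.FiniteIndex) (hC : C ∈ E.IMS) :
    (E.adj (E.jonesDiff hE hC).1).1 = (E.jonesDiff hE hC).1.1 := by
  refine IsAdjointPair.unique hE (E.adj_spec _) fun x y => ?_
  have h1 := E.jones_isAdjointPair (E.compat hC) (E.compat_compatible hC) x y
  have h2 := E.jones_isAdjointPair E E.compatible_self x y
  rw [jones_apply, jones_apply] at h1 h2
  rw [jonesDiff_apply, jonesDiff_apply, star_sub, sub_mul, mul_sub, map_sub, map_sub, h1, h2]

/-- The inner product `⟨e_C - e_B, e_D - e_B⟩_A` in terms of a quasi-basis. -/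
theorem innerBasic_jonesDiff (E : CondExp B) (hE : E.FiniteIndex) (hC : C ∈ E.IMS)
    (hD : D ∈ E.IMS) {F : CondExp C} {F' : CondExp D} (hF : E.Compatible F)
    (hF' : E.Compatible F') {n : ℕ} {l : Fin n → A} (hl : E.IsQuasiBasis l) :
    E.innerBasic hE (E.jonesDiff hE hC) (E.jonesDiff hE hD) =
      Ring.inverse E.index * ∑ i, (F (F' (l i) - E (l i)) - E (F' (l i) - E (l i))) * star (l i) := by
  rw [innerBasic, E.dual_eq_of_isQuasiBasis hE hl]
  refine congrArg (Ring.inverse E.index * ·) (Finset.sum_congr rfl fun i _ => ?_)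
  refine congrArg (· * star (l i)) ?_
  -- The expectations inside `jonesDiff` are chosen ones; uniqueness identifies them with the given
  -- `F` and `F'`.
  have h1 : ∀ x, E.compat hC x = F x := E.compatible_unique hE (E.compat_compatible hC) hF
  have h2 : ∀ x, E.compat hD x = F' x := E.compatible_unique hE (E.compat_compatible hD) hF'
  change (E.adj (E.jonesDiff hE hC).1).1 ((E.jonesDiff hE hD).1.1 (l i)) = _
  rw [adj_jonesDiff, jonesDiff_apply, jonesDiff_apply, h1, h2]

section Group

variable {G : Type*} [Group G] {u : G →* unitary A}

/-- Representatives of the left cosets of `H` form a quasi-basis. -/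
theorem isQuasiBasis_out {H : Subgroup G} [Finite (G ⧸ H)]
    (hu : Dense (Submodule.span ℂ (Set.range fun g => (u g : A)) : Set A)) (E : CondExp B)
    (hE : RestrictsTo u H E.toLinearMap) :
    E.IsQuasiBasis fun i => (u ((Finite.equivFin (G ⧸ H)).symm i).out : A) := by
  have := Fintype.ofFinite (G ⧸ H)
  intro x
  rw [(Finite.equivFin (G ⧸ H)).symm.sum_comp
      (fun c => E (x * u c.out) * star (u c.out : A)),
    (Finite.equivFin (G ⧸ H)).symm.sum_comp (fun c => (u c.out : A) * E (star (u c.out : A) * x))]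
  exact ⟨(hE.sum_apply_mul_out hu E.continuous x).symm,
    (hE.sum_out_mul_apply hu E.continuous x).symm⟩

/-- Each summand `u_c u_c⋆` is `1`, so the index merely counts cosets. -/
theorem index_eq_of_restrictsTo {H : Subgroup G} [Finite (G ⧸ H)]
    (hu : Dense (Submodule.span ℂ (Set.range fun g => (u g : A)) : Set A)) (E : CondExp B)
    (hE : RestrictsTo u H E.toLinearMap) : E.index = algebraMap ℂ A H.index := by
  rw [E.index_eq (isQuasiBasis_out hu E hE), Subgroup.index]
  simp [Unitary.mul_star_self_of_mem (u _).2]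

theorem compatible_of_restrictsTo {H K : Subgroup G} (hHK : H ≤ K)
    (hu : Dense (Submodule.span ℂ (Set.range fun g => (u g : A)) : Set A)) (E : CondExp B)
    (hE : RestrictsTo u H E.toLinearMap) (F : CondExp C) (hF : RestrictsTo u K F.toLinearMap) :
    E.Compatible F := by
  classical
  refine LinearMap.eq_of_dense_span hu (S := E.toLinearMap)
    (T := E.toLinearMap.comp F.toLinearMap) E.continuous (E.continuous.comp F.continuous) ?_
  rintro _ ⟨g, rfl⟩
  rw [LinearMap.comp_apply, hF.apply]
  split_ifs with h
  · rfl
  · rw [map_zero, hE.2 g fun h' => h (hHK h')]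

variable [Nontrivial A] {H K L : Subgroup G}

/-- Each summand is the indicator of `K ⊓ L` minus that of `H` at a representative, so the sum is
the number of cosets inside `K ⊓ L` less the trivial one. The case `C = D` provides the norms of
`e_C - e_B`. -/
theorem norm_innerBasic_jonesDiff (hHK : H ≤ K) (hHL : H ≤ L) [H.FiniteIndex]
    (hu : Dense (Submodule.span ℂ (Set.range fun g => (u g : A)) : Set A)) (E : CondExp B)
    (hE : RestrictsTo u H E.toLinearMap) (F : CondExp C) (hF : RestrictsTo u K F.toLinearMap)
    (F' : CondExp D) (hF' : RestrictsTo u L F'.toLinearMap) (hfin : E.FiniteIndex)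
    (hC : C ∈ E.IMS) (hD : D ∈ E.IMS) :
    ‖E.innerBasic hfin (E.jonesDiff hfin hC) (E.jonesDiff hfin hD)‖ =
      ((H.relIndex (K ⊓ L) : ℝ) - 1) / H.index := by
  classical
  have := Fintype.ofFinite (G ⧸ H)
  rw [E.innerBasic_jonesDiff hfin hC hD (compatible_of_restrictsTo hHK hu E hE F hF)
    (compatible_of_restrictsTo hHL hu E hE F' hF') (isQuasiBasis_out hu E hE),
    (Finite.equivFin (G ⧸ H)).symm.sum_comp (fun c =>
      (F (F' (u c.out) - E (u c.out)) - E (F' (u c.out) - E (u c.out))) * star (u c.out : A)),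
    index_eq_of_restrictsTo hu E hE]
  have h : ∀ g : G, (F (F' (u g) - E (u g)) - E (F' (u g) - E (u g))) * star (u g : A)
      = (if g ∈ K ⊓ L then 1 else 0) - if g ∈ H then 1 else 0 := by
    intro g
    have h1 : (u g : A) * star (u g : A) = 1 := Unitary.mul_star_self_of_mem (u g).2
    rw [hF'.apply, hE.apply]
    by_cases hH : g ∈ H
    · simp [hH, hHK hH, hHL hH]
    · by_cases hgL : g ∈ L <;> by_cases hgK : g ∈ K <;>
        simp [hH, hgL, hgK, hF.apply, hE.apply, h1]
  have hpos : 1 ≤ H.relIndex (K ⊓ L) := Nat.one_le_iff_ne_zero.2 (relIndex_ne_zero_of_finiteIndex H _)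
  have hn : (H.index : ℂ) ≠ 0 := Nat.cast_ne_zero.2 Subgroup.FiniteIndex.index_ne_zero
  have hinv : Ring.inverse (algebraMap ℂ A H.index) = algebraMap ℂ A (H.index : ℂ)⁻¹ :=
    Ring.inverse_unit (Units.map (algebraMap ℂ A).toMonoidHom (Units.mk0 _ hn))
  simp only [h, Finset.sum_sub_distrib, Finset.sum_boole,
    card_quotient_out_mem (le_inf hHK hHL), card_quotient_out_mem (le_refl H),
    Subgroup.relIndex_self, Nat.cast_one]
  -- Natural subtraction, harmless because the relative index is at least `1`, exhibits the scalar
  -- as a natural number whose norm is itself.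
  have h2 : (H.relIndex (K ⊓ L) : A) - 1 = algebraMap ℂ A ((H.relIndex (K ⊓ L) - 1 : ℕ) : ℂ) := by
    rw [map_natCast, Nat.cast_sub hpos, Nat.cast_one]
  rw [hinv, h2, ← map_mul, norm_algebraMap', norm_mul, norm_inv, Complex.norm_natCast,
    Complex.norm_natCast, Nat.cast_sub hpos, Nat.cast_one, div_eq_inv_mul]

theorem cos_interiorAngle (hHK : H ≤ K) (hHL : H ≤ L) (hK : H ≠ K) (hL : H ≠ L) [H.FiniteIndex]
    (hu : Dense (Submodule.span ℂ (Set.range fun g => (u g : A)) : Set A)) (E : CondExp B)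
    (hE : RestrictsTo u H E.toLinearMap) (F : CondExp C) (hF : RestrictsTo u K F.toLinearMap)
    (F' : CondExp D) (hF' : RestrictsTo u L F'.toLinearMap) (hfin : E.FiniteIndex)
    (hC : C ∈ E.IMS) (hD : D ∈ E.IMS) :
    Real.cos (E.interiorAngle hfin hC hD) = ((H.relIndex (K ⊓ L) : ℝ) - 1) /
      (√((H.relIndex K : ℝ) - 1) * √((H.relIndex L : ℝ) - 1)) := by
  have hrel : ∀ M : Subgroup G, H ≤ M → H ≠ M → (0 : ℝ) < (H.relIndex M : ℝ) - 1 := by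
    intro M h h'
    have h0 : H.relIndex M ≠ 0 := relIndex_ne_zero_of_finiteIndex H _
    have h1 : H.relIndex M ≠ 1 := fun h1 => h' (le_antisymm h (Subgroup.relIndex_eq_one.1 h1))
    have h2 : 1 < H.relIndex M := by omega
    exact sub_pos.2 (by exact_mod_cast h2)
  have hle : ∀ M : Subgroup G, K ⊓ L ≤ M →
      (H.relIndex (K ⊓ L) : ℝ) - 1 ≤ (H.relIndex M : ℝ) - 1 := by
    intro M hM
    -- The tower formula makes `[K ∩ L : H]` a divisor of the nonzero number `[M : H]`.
    have h := Nat.le_of_dvd (Nat.pos_of_ne_zero (relIndex_ne_zero_of_finiteIndex H _))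
      (Dvd.intro _ (Subgroup.relIndex_mul_relIndex H (K ⊓ L) M (le_inf hHK hHL) hM))
    exact sub_le_sub_right (by exact_mod_cast h) 1
  have hn : (0 : ℝ) < H.index :=
    Nat.cast_pos.2 (Nat.pos_of_ne_zero Subgroup.FiniteIndex.index_ne_zero)
  have ha := hrel K hHK hK
  have hb := hrel L hHL hL
  have h1 : (1 : ℝ) ≤ H.relIndex (K ⊓ L) :=
    Nat.one_le_cast.2 (Nat.one_le_iff_ne_zero.2 (relIndex_ne_zero_of_finiteIndex H _))
  have hab : 0 < √((H.relIndex K : ℝ) - 1) * √((H.relIndex L : ℝ) - 1) :=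
    mul_pos (Real.sqrt_pos.2 ha) (Real.sqrt_pos.2 hb)
  have hq : ‖E.innerBasic hfin (E.jonesDiff hfin hC) (E.jonesDiff hfin hD)‖ /
      (E.normBasic hfin (E.jonesDiff hfin hC) * E.normBasic hfin (E.jonesDiff hfin hD)) =
      ((H.relIndex (K ⊓ L) : ℝ) - 1) /
      (√((H.relIndex K : ℝ) - 1) * √((H.relIndex L : ℝ) - 1)) := by
    -- Each norm contributes one factor `√[G:H]` to the denominator; together they cancel the
    -- `[G:H]` of the inner product.
    rw [normBasic, normBasic, norm_innerBasic_jonesDiff hHK hHL hu E hE F hF F' hF',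
      norm_innerBasic_jonesDiff hHK hHK hu E hE F hF F hF,
      norm_innerBasic_jonesDiff hHL hHL hu E hE F' hF' F' hF', inf_idem, inf_idem,
      Real.sqrt_div ha.le, Real.sqrt_div hb.le, div_mul_div_comm, Real.mul_self_sqrt hn.le,
      div_div_div_cancel_right₀ hn.ne']
  rw [interiorAngle, hq, Real.cos_arccos]
  · exact le_trans (by norm_num) (div_nonneg (sub_nonneg.2 h1) hab.le)
  -- The numerator is split as a product of two equal square roots, one bounded through `K`, the
  -- other through `L`.
  · rw [div_le_one hab, ← Real.mul_self_sqrt (sub_nonneg.2 h1)]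
    exact mul_le_mul (Real.sqrt_le_sqrt (hle K inf_le_left)) (Real.sqrt_le_sqrt (hle L inf_le_right))
      (Real.sqrt_nonneg _) (Real.sqrt_nonneg _)

end Group

end CondExp

/-! ### From a retract to a conditional expectation -/

/-- A star homomorphism extending the inclusion `ℂ[M] ⊆ ℂ[G]`, together with a linear contraction
in the opposite direction that extends the canonical projection `ℂ[G] → ℂ[M]`. -/
structure SubgroupRetract {G A A' : Type*} [Group G] [CStarAlgebra A] [CStarAlgebra A']
    {M : Subgroup G} (u : G →* unitary A) (v : M →* unitary A') where
  incl : A' →⋆ₐ[ℂ] A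
  retract : A →ₗ[ℂ] A'
  incl_apply : ∀ m : M, incl (v m) = u m
  retract_mem : ∀ m : M, retract (u m) = v m
  retract_notMem : ∀ g ∉ M, retract (u g) = 0
  norm_retract_le : ∀ a, ‖retract a‖ ≤ ‖a‖

namespace SubgroupRetract

variable {G A A' : Type*} [Group G] [CStarAlgebra A] [CStarAlgebra A']
  {M : Subgroup G} {u : G →* unitary A} {v : M →* unitary A'}

theorem norm_incl_le (R : SubgroupRetract u v) (b : A') : ‖R.incl b‖ ≤ ‖b‖ :=
  NonUnitalStarAlgHom.norm_apply_le R.incl b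

theorem continuous_incl (R : SubgroupRetract u v) : Continuous R.incl :=
  LinearMap.continuous_of_contractive (T := (R.incl : A' →ₐ[ℂ] A).toLinearMap) R.norm_incl_le

theorem continuous_retract (R : SubgroupRetract u v) : Continuous R.retract :=
  LinearMap.continuous_of_contractive R.norm_retract_le

theorem retract_incl (R : SubgroupRetract u v)
    (hv : Dense (Submodule.span ℂ (Set.range fun m => (v m : A')) : Set A')) (b : A') :
    R.retract (R.incl b) = b := by
  refine LinearMap.eq_of_dense_span hv
    (S := R.retract.comp (R.incl : A' →ₐ[ℂ] A).toLinearMap) (T := LinearMap.id)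
    (R.continuous_retract.comp R.continuous_incl) continuous_id ?_ b
  rintro _ ⟨m, rfl⟩
  exact (congrArg R.retract (R.incl_apply m)).trans (R.retract_mem m)

/-- The projection of `A` onto the image of `A'`. -/
noncomputable def proj (R : SubgroupRetract u v) : A →ₗ[ℂ] A :=
  (R.incl : A' →ₐ[ℂ] A).toLinearMap.comp R.retract

theorem proj_apply (R : SubgroupRetract u v) (a : A) : R.proj a = R.incl (R.retract a) := rfl

theorem norm_proj_le (R : SubgroupRetract u v) (a : A) : ‖R.proj a‖ ≤ ‖a‖ :=
  (R.norm_incl_le _).trans (R.norm_retract_le a)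

theorem continuous_proj (R : SubgroupRetract u v) : Continuous R.proj :=
  LinearMap.continuous_of_contractive R.norm_proj_le

theorem restrictsTo_proj (R : SubgroupRetract u v) : RestrictsTo u M R.proj :=
  ⟨fun g hg => by rw [proj_apply, R.retract_mem ⟨g, hg⟩, R.incl_apply],
    fun g hg => by rw [proj_apply, R.retract_notMem g hg, map_zero]⟩

/-- Describing the range by fixed points makes it closed and turns inclusions between ranges into
equations testable on generators. -/
theorem mem_range_iff (R : SubgroupRetract u v)
    (hv : Dense (Submodule.span ℂ (Set.range fun m => (v m : A')) : Set A')) (a : A) :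
    a ∈ R.incl.range ↔ R.proj a = a := by
  constructor
  · rintro ⟨b, rfl⟩
    exact congrArg R.incl (R.retract_incl hv b)
  · exact fun h => ⟨_, h⟩

theorem isClosed_range (R : SubgroupRetract u v)
    (hv : Dense (Submodule.span ℂ (Set.range fun m => (v m : A')) : Set A')) :
    IsClosed (R.incl.range : Set A) := by
  have h : (R.incl.range : Set A) = {a | R.proj a = a} := Set.ext (R.mem_range_iff hv)
  rw [h]
  exact isClosed_eq R.continuous_proj continuous_id

theorem proj_star (R : SubgroupRetract u v)
    (hu : Dense (Submodule.span ℂ (Set.range fun g => (u g : A)) : Set A)) (a : A) :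
    R.proj (star a) = star (R.proj a) := by
  classical
  have hc := R.continuous_proj
  -- Conjugating `proj` by the conjugate-linear star on both sides gives a complex linear map again,
  -- so density applies.
  let σ : A →ₗ⋆[ℂ] A := (starLinearEquiv ℂ : A ≃ₗ⋆[ℂ] A).toLinearMap
  have key := LinearMap.eq_of_dense_span hu (S := R.proj) (T := σ.comp (R.proj.comp σ)) hc
    (continuous_star.comp (hc.comp continuous_star)) ?_ (star a)
  · simpa [σ] using key
  · rintro _ ⟨g, rfl⟩
    change R.proj (u g) = star (R.proj (star (u g : A)))
    rw [← coe_unitary_inv, R.restrictsTo_proj.apply, R.restrictsTo_proj.apply]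
    simp only [inv_mem_iff]
    split_ifs
    · rw [coe_unitary_inv, star_star]
    · rw [star_zero]

/-- Left translation by `m ∈ M` preserves both `M` and its complement. Density is used twice: in `a`
for a fixed group unitary, then in `b`. -/
theorem proj_incl_mul (R : SubgroupRetract u v)
    (hu : Dense (Submodule.span ℂ (Set.range fun g => (u g : A)) : Set A))
    (hv : Dense (Submodule.span ℂ (Set.range fun m => (v m : A')) : Set A')) (b : A') (a : A) :
    R.proj (R.incl b * a) = R.incl b * R.proj a := by
  classical
  have hc := R.continuous_proj
  have hi := R.continuous_incl
  have h : ∀ (m : M) (x : A), R.proj (u m * x) = u m * R.proj x := by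
    intro m x
    refine LinearMap.eq_of_dense_span hu (S := R.proj.comp (LinearMap.mulLeft ℂ (u m : A)))
      (T := (LinearMap.mulLeft ℂ (u m : A)).comp R.proj) (hc.comp (continuous_const_mul _))
      ((continuous_const_mul _).comp hc) ?_ x
    rintro _ ⟨g, rfl⟩
    change R.proj (u m * u g) = u m * R.proj (u g)
    rw [← coe_unitary_mul, R.restrictsTo_proj.apply, R.restrictsTo_proj.apply,
      M.mul_mem_cancel_left m.2, mul_ite, mul_zero, coe_unitary_mul]
  refine LinearMap.eq_of_dense_span hv
    (S := R.proj.comp ((LinearMap.mulRight ℂ a).comp (R.incl : A' →ₐ[ℂ] A).toLinearMap))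
    (T := (LinearMap.mulRight ℂ (R.proj a)).comp (R.incl : A' →ₐ[ℂ] A).toLinearMap)
    (hc.comp ((continuous_mul_const _).comp hi)) ((continuous_mul_const _).comp hi) ?_ b
  rintro _ ⟨m, rfl⟩
  change R.proj (R.incl (v m) * a) = R.incl (v m) * R.proj a
  rw [R.incl_apply, h]

theorem proj_mul_incl (R : SubgroupRetract u v)
    (hu : Dense (Submodule.span ℂ (Set.range fun g => (u g : A)) : Set A))
    (hv : Dense (Submodule.span ℂ (Set.range fun m => (v m : A')) : Set A')) (b : A') (a : A) :
    R.proj (a * R.incl b) = R.proj a * R.incl b := by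
  rw [← star_star (a * R.incl b), R.proj_star hu, star_mul, ← StarHomClass.map_star R.incl b,
    R.proj_incl_mul hu hv, R.proj_star hu, star_mul, star_star, StarHomClass.map_star, star_star]

/-- `E (a⋆ a) = ∑ b_c⋆ b_c` with `b_c = E (u_c⋆ a)`, where the `u_c` come from representatives of
the left cosets. -/
theorem proj_star_mul_self (R : SubgroupRetract u v) [Fintype (G ⧸ M)]
    (hu : Dense (Submodule.span ℂ (Set.range fun g => (u g : A)) : Set A))
    (hv : Dense (Submodule.span ℂ (Set.range fun m => (v m : A')) : Set A')) (a : A) :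
    R.proj (star a * a) =
      ∑ c : G ⧸ M, star (R.proj (star (u c.out : A) * a)) * R.proj (star (u c.out : A) * a) := by
  -- Only the right factor `a` is expanded; the coefficients `proj (u_c⋆ a)` lie in the range and
  -- come out on the right.
  conv_lhs =>
    enter [2, 2]
    rw [← R.restrictsTo_proj.sum_out_mul_apply hu R.continuous_proj a]
  rw [Finset.mul_sum, map_sum]
  refine Finset.sum_congr rfl fun c _ => ?_
  rw [← mul_assoc, proj_apply R (star (u c.out : A) * a), R.proj_mul_incl hu hv, ← proj_apply,
    ← R.proj_star hu, star_mul, star_star]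

theorem exists_proj_star_mul_self_eq (R : SubgroupRetract u v) [Finite (G ⧸ M)]
    (hu : Dense (Submodule.span ℂ (Set.range fun g => (u g : A)) : Set A))
    (hv : Dense (Submodule.span ℂ (Set.range fun m => (v m : A')) : Set A')) (a : A) :
    ∃ b, R.proj (star a * a) = star b * b := by
  have := Fintype.ofFinite (G ⧸ M)
  -- In the spectral order the positive elements are exactly the `star b * b`, so a sum of such
  -- elements is again one.
  let := CStarAlgebra.spectralOrder A
  let := CStarAlgebra.spectralOrderedRing A
  rw [← CStarAlgebra.nonneg_iff_eq_star_mul_self, R.proj_star_mul_self hu hv]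
  exact Finset.sum_nonneg fun c _ => star_mul_self_nonneg _

/-- The conditional expectation of `A` onto the image of `A'`. -/
noncomputable def condExp (R : SubgroupRetract u v) [Finite (G ⧸ M)]
    (hu : Dense (Submodule.span ℂ (Set.range fun g => (u g : A)) : Set A))
    (hv : Dense (Submodule.span ℂ (Set.range fun m => (v m : A')) : Set A')) :
    CondExp R.incl.range where
  toLinearMap := R.proj
  mem' a := ⟨R.retract a, rfl⟩
  fix' b hb := (R.mem_range_iff hv b).1 hb
  bimod' := by
    rintro _ ⟨b, rfl⟩ _ ⟨c, rfl⟩ a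
    exact (R.proj_mul_incl hu hv c _).trans (congrArg (· * R.incl c) (R.proj_incl_mul hu hv b a))
  pos' := R.exists_proj_star_mul_self_eq hu hv
  contr' := R.norm_proj_le

section Comparison

variable {A'' : Type*} [CStarAlgebra A''] {H : Subgroup G} {w : H →* unitary A''}

/-- For `g ∈ M \ H` the unitary `u g` lies in the larger range but is killed by the projection onto
the smaller one; as `A ≠ 0`, a unitary is not zero. -/
theorem range_incl_ne [Nontrivial A] (R : SubgroupRetract u v) (S : SubgroupRetract u w)
    (hw : Dense (Submodule.span ℂ (Set.range fun h => (w h : A'')) : Set A''))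
    (hle : H ≤ M) (hne : H ≠ M) : R.incl.range ≠ S.incl.range := by
  intro heq
  obtain ⟨g, hg, hgH⟩ := SetLike.exists_of_lt (lt_of_le_of_ne hle hne)
  have hmem : (u g : A) ∈ S.incl.range := heq ▸ ⟨v ⟨g, hg⟩, R.incl_apply ⟨g, hg⟩⟩
  rw [S.mem_range_iff hw, S.restrictsTo_proj.2 g hgH] at hmem
  have h1 : (1 : A) = 0 := by
    rw [← Unitary.mul_star_self_of_mem (u g).2, ← hmem, zero_mul]
  exact one_ne_zero h1

theorem range_incl_le (R : SubgroupRetract u v) (S : SubgroupRetract u w)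
    (hv : Dense (Submodule.span ℂ (Set.range fun m => (v m : A')) : Set A'))
    (hw : Dense (Submodule.span ℂ (Set.range fun h => (w h : A'')) : Set A''))
    (hle : H ≤ M) : S.incl.range ≤ R.incl.range := by
  rintro _ ⟨b, rfl⟩
  rw [R.mem_range_iff hv]
  refine LinearMap.eq_of_dense_span hw
    (S := R.proj.comp (S.incl : A'' →ₐ[ℂ] A).toLinearMap)
    (T := (S.incl : A'' →ₐ[ℂ] A).toLinearMap) (R.continuous_proj.comp S.continuous_incl)
    S.continuous_incl ?_ b
  rintro _ ⟨h, rfl⟩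
  change R.proj (S.incl (w h)) = S.incl (w h)
  rw [S.incl_apply, R.restrictsTo_proj.1 _ (hle h.2)]

end Comparison

end SubgroupRetract

/-- The form common to the reduced and the universal case: nothing is needed beyond dense spans and
three retracts. -/
theorem exists_cos_interiorAngle_eq {G A A₁ A₂ A₃ : Type*} [Group G] [CStarAlgebra A]
    [Nontrivial A] [CStarAlgebra A₁] [CStarAlgebra A₂] [CStarAlgebra A₃] {H K L : Subgroup G}
    (hHK : H ≤ K) (hHL : H ≤ L) (hK : H ≠ K) (hL : H ≠ L) (hfin : H.FiniteIndex)
    {u : G →* unitary A} {v₁ : H →* unitary A₁} {v₂ : K →* unitary A₂} {v₃ : L →* unitary A₃}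
    (hu : Dense (Submodule.span ℂ (Set.range fun g => (u g : A)) : Set A))
    (hv₁ : Dense (Submodule.span ℂ (Set.range fun m => (v₁ m : A₁)) : Set A₁))
    (hv₂ : Dense (Submodule.span ℂ (Set.range fun m => (v₂ m : A₂)) : Set A₂))
    (hv₃ : Dense (Submodule.span ℂ (Set.range fun m => (v₃ m : A₃)) : Set A₃))
    (R₁ : SubgroupRetract u v₁) (R₂ : SubgroupRetract u v₂) (R₃ : SubgroupRetract u v₃) :
    ∃ (ιH : A₁ →⋆ₐ[ℂ] A) (ιK : A₂ →⋆ₐ[ℂ] A) (ιL : A₃ →⋆ₐ[ℂ] A),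
      (Function.Injective ιH ∧ ∀ h : H, ιH (v₁ h) = u (h : G)) ∧
      (Function.Injective ιK ∧ ∀ k : K, ιK (v₂ k) = u (k : G)) ∧
      (Function.Injective ιL ∧ ∀ l : L, ιL (v₃ l) = u (l : G)) ∧
      IsClosed (ιH.range : Set A) ∧ ιK.range ≠ ιH.range ∧ ιL.range ≠ ιH.range ∧
      ∃ E : CondExp ιH.range,
        (∀ g : G, g ∈ H → E (u g) = u g) ∧ (∀ g : G, g ∉ H → E (u g) = 0) ∧
        ∃ (hE : E.FiniteIndex) (hC : ιK.range ∈ E.IMS) (hD : ιL.range ∈ E.IMS),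
          Real.cos (E.interiorAngle hE hC hD) =
            ((H.relIndex (K ⊓ L) : ℝ) - 1) /
              (√((H.relIndex K : ℝ) - 1) * √((H.relIndex L : ℝ) - 1)) := by
  have : K.FiniteIndex := Subgroup.finiteIndex_of_le hHK
  have : L.FiniteIndex := Subgroup.finiteIndex_of_le hHL
  let E := R₁.condExp hu hv₁
  let F := R₂.condExp hu hv₂
  let F' := R₃.condExp hu hv₃
  have hE : RestrictsTo u H E.toLinearMap := R₁.restrictsTo_proj
  have hF : RestrictsTo u K F.toLinearMap := R₂.restrictsTo_proj
  have hF' : RestrictsTo u L F'.toLinearMap := R₃.restrictsTo_proj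
  have hC : R₂.incl.range ∈ E.IMS := ⟨R₂.isClosed_range hv₂, R₂.range_incl_le R₁ hv₂ hv₁ hHK, F,
    CondExp.compatible_of_restrictsTo hHK hu E hE F hF⟩
  have hD : R₃.incl.range ∈ E.IMS := ⟨R₃.isClosed_range hv₃, R₃.range_incl_le R₁ hv₃ hv₁ hHL, F',
    CondExp.compatible_of_restrictsTo hHL hu E hE F' hF'⟩
  have hqb : E.FiniteIndex := ⟨_, _, CondExp.isQuasiBasis_out hu E hE⟩
  exact ⟨R₁.incl, R₂.incl, R₃.incl,
    ⟨Function.LeftInverse.injective (R₁.retract_incl hv₁), R₁.incl_apply⟩,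
    ⟨Function.LeftInverse.injective (R₂.retract_incl hv₂), R₂.incl_apply⟩,
    ⟨Function.LeftInverse.injective (R₃.retract_incl hv₃), R₃.incl_apply⟩,
    R₁.isClosed_range hv₁, R₂.range_incl_ne R₁ hv₁ hHK hK,
    R₃.range_incl_ne R₁ hv₁ hHL hL, E, hE.1, hE.2, hqb, hC, hD,
    CondExp.cos_interiorAngle hHK hHL hK hL hu E hE F hF F' hF' hqb hC hD⟩

/-! ### Restricting retracts to generated C*-algebras -/

section Generated

variable {G 𝓑 : Type*} [Group G] [CStarAlgebra 𝓑]

noncomputable instance (u : G →* unitary 𝓑) : CStarAlgebra (generatedCStar u) :=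
  StarSubalgebra.cstarAlgebra (generatedCStar u)
    (h_closed := StarSubalgebra.isClosed_topologicalClosure _)

/-- The homomorphism `u`, regarded as a homomorphism to the C*-algebra it generates. -/
noncomputable def generatedHom (u : G →* unitary 𝓑) : G →* unitary (generatedCStar u) where
  toFun g := ⟨⟨u g, mem_generatedCStar u g⟩,
    Subtype.ext (Unitary.star_mul_self_of_mem (u g).2),
    Subtype.ext (Unitary.mul_star_self_of_mem (u g).2)⟩
  map_one' := Subtype.ext (Subtype.ext (show (u 1 : 𝓑) = 1 by rw [map_one]; rfl))
  map_mul' g h := Subtype.ext (Subtype.ext (coe_unitary_mul u g h))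

/-- The unitaries `u g` are closed under products and adjoints, so the star algebra they generate is
just their span. -/
theorem coe_generatedCStar (u : G →* unitary 𝓑) :
    (generatedCStar u : Set 𝓑) =
      closure (Submodule.span ℂ (Set.range fun g => (u g : 𝓑)) : Set 𝓑) := by
  refine congrArg closure ?_
  have hstar : star (Set.range fun g => (u g : 𝓑)) = Set.range fun g => (u g : 𝓑) := by
    ext x
    constructor
    · rintro ⟨g, hg⟩
      exact ⟨g⁻¹, (coe_unitary_inv u g).trans (star_eq_iff_star_eq.1 hg.symm)⟩
    · rintro ⟨g, rfl⟩
      exact ⟨g⁻¹, coe_unitary_inv u g⟩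
  have hclosure : (Submonoid.closure (Set.range fun g => (u g : 𝓑)) : Set 𝓑) =
      Set.range fun g => (u g : 𝓑) := by
    have h : (Set.range fun g => (u g : 𝓑)) =
        (MonoidHom.mrange ((unitary 𝓑).subtype.comp u) : Set 𝓑) := rfl
    rw [h, Submonoid.closure_eq]
  have h : (StarAlgebra.adjoin ℂ (Set.range fun g => (u g : 𝓑))).toSubalgebra.toSubmodule =
      Submodule.span ℂ (Set.range fun g => (u g : 𝓑)) := by
    rw [StarAlgebra.adjoin_toSubalgebra, hstar, Set.union_self, Algebra.adjoin_eq_span, hclosure]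
  exact congrArg SetLike.coe h

theorem dense_span_generatedHom (u : G →* unitary 𝓑) :
    Dense (Submodule.span ℂ (Set.range fun g => (generatedHom u g : generatedCStar u)) :
      Set (generatedCStar u)) := by
  rw [Subtype.dense_iff]
  refine (coe_generatedCStar u).subset.trans (closure_mono ?_)
  have h := Submodule.map_span (generatedCStar u).toSubalgebra.toSubmodule.subtype
    (Set.range fun g => (generatedHom u g : generatedCStar u))
  rw [← Set.range_comp] at h
  exact (congrArg SetLike.coe h).symm.subset

variable {𝓑' : Type*} [CStarAlgebra 𝓑'] {M : Subgroup G} {u : G →* unitary 𝓑}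
  {v : M →* unitary 𝓑'}

/-- The preimage of a closed subspace is a closed subspace, so it suffices that it contains the
generators. -/
theorem mem_generatedCStar_of_forall {G' : Type*} [Group G'] {w : G' →* unitary 𝓑'}
    {T : 𝓑 →ₗ[ℂ] 𝓑'} (hT : Continuous T)
    (h : ∀ g, T (u g) ∈ generatedCStar w) {x : 𝓑} (hx : x ∈ generatedCStar u) :
    T x ∈ generatedCStar w := by
  have hcl : IsClosed (generatedCStar w : Set 𝓑') := StarSubalgebra.isClosed_topologicalClosure _
  have hx' : x ∈ closure (Submodule.span ℂ (Set.range fun g => (u g : 𝓑)) : Set 𝓑) :=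
    coe_generatedCStar u ▸ hx
  refine closure_minimal (t := T ⁻¹' (generatedCStar w)) ?_ (hcl.preimage hT) hx'
  have hle : Submodule.span ℂ (Set.range fun g => (u g : 𝓑)) ≤
      (generatedCStar w).toSubalgebra.toSubmodule.comap T := by
    rw [Submodule.span_le]
    rintro _ ⟨g, rfl⟩
    exact h g
  exact hle

theorem SubgroupRetract.incl_mem (R : SubgroupRetract u v) (x : generatedCStar v) :
    R.incl x ∈ generatedCStar u :=
  mem_generatedCStar_of_forall (T := (R.incl : 𝓑' →ₐ[ℂ] 𝓑).toLinearMap) R.continuous_incl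
    (fun m => by
      change R.incl (v m) ∈ _
      rw [R.incl_apply]
      exact mem_generatedCStar u _) x.2

theorem SubgroupRetract.retract_mem_generatedCStar (R : SubgroupRetract u v)
    (x : generatedCStar u) : R.retract x ∈ generatedCStar v :=
  mem_generatedCStar_of_forall (T := R.retract) R.continuous_retract
    (fun g => by
      by_cases hg : g ∈ M
      · rw [R.retract_mem ⟨g, hg⟩]
        exact mem_generatedCStar v _
      · rw [R.retract_notMem g hg]
        exact zero_mem _) x.2

/-- A pair of maps between ambient C*-algebras restricts to the generated C*-algebras. -/
noncomputable def SubgroupRetract.generated (R : SubgroupRetract u v) :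
    SubgroupRetract (generatedHom u) (generatedHom v) where
  incl := (R.incl.comp (generatedCStar v).subtype).codRestrict (generatedCStar u) R.incl_mem
  retract :=
    { toFun := fun x => ⟨R.retract x, R.retract_mem_generatedCStar x⟩
      map_add' := fun x y => Subtype.ext (map_add R.retract (x : 𝓑) y)
      map_smul' := fun c x => Subtype.ext (map_smul R.retract c (x : 𝓑)) }
  incl_apply m := Subtype.ext (R.incl_apply m)
  retract_mem m := Subtype.ext (R.retract_mem m)
  retract_notMem g hg := Subtype.ext (R.retract_notMem g hg)
  norm_retract_le a := R.norm_retract_le a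

end Generated

/-! ### Amplification and compression on `ℓ²` -/

section Amplification

variable {α β ι : Type*}

theorem memℓp_comp_of_injective {φ : α → β} (hφ : Function.Injective φ) (f : L2 β) :
    Memℓp (fun a => f (φ a)) 2 :=
  memℓp_gen (((lp.memℓp f).summable (by simp)).comp_injective hφ)

theorem memℓp_extend {φ : α → β} (hφ : Function.Injective φ) (f : L2 α) :
    Memℓp (Function.extend φ f 0) 2 := by
  refine memℓp_gen ?_
  have h : (fun b => ‖Function.extend φ f 0 b‖ ^ (2 : ℝ≥0∞).toReal) =
      Function.extend φ (fun a => ‖f a‖ ^ (2 : ℝ≥0∞).toReal) 0 := by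
    ext b
    by_cases hb : ∃ a, φ a = b
    · obtain ⟨a, rfl⟩ := hb
      rw [hφ.extend_apply, hφ.extend_apply]
    · simp [Function.extend_apply' _ _ _ hb]
  rw [h]
  exact (summable_extend_zero hφ).2 ((lp.memℓp f).summable (by simp))

/-- Composition with an injection `φ : α → β`, as a map `ℓ²(β) → ℓ²(α)`. -/
noncomputable def l2Compₗ {φ : α → β} (hφ : Function.Injective φ) : L2 β →ₗ[ℂ] L2 α where
  toFun f := ⟨fun a => f (φ a), memℓp_comp_of_injective hφ f⟩
  map_add' _ _ := rfl
  map_smul' _ _ := rfl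

/-- Extension by zero along an injection `φ : α → β`, as a map `ℓ²(α) → ℓ²(β)`. -/
noncomputable def l2Extendₗ {φ : α → β} (hφ : Function.Injective φ) : L2 α →ₗ[ℂ] L2 β where
  toFun f := ⟨Function.extend φ f 0, memℓp_extend hφ f⟩
  map_add' f g := by
    refine lp.ext (funext fun b => ?_)
    change Function.extend φ (fun a => f a + g a) 0 b =
      Function.extend φ f 0 b + Function.extend φ g 0 b
    by_cases hb : ∃ a, φ a = b
    · obtain ⟨a, rfl⟩ := hb
      rw [hφ.extend_apply, hφ.extend_apply, hφ.extend_apply]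
    · simp [Function.extend_apply' _ _ _ hb]
  map_smul' c f := by
    refine lp.ext (funext fun b => ?_)
    change Function.extend φ (fun a => c • f a) 0 b = c • Function.extend φ f 0 b
    by_cases hb : ∃ a, φ a = b
    · obtain ⟨a, rfl⟩ := hb
      rw [hφ.extend_apply, hφ.extend_apply]
    · simp [Function.extend_apply' _ _ _ hb]

variable {φ : α → β} (hφ : Function.Injective φ)

theorem l2Extendₗ_apply (f : L2 α) (a : α) : l2Extendₗ hφ f (φ a) = f a :=
  hφ.extend_apply _ _ _

theorem l2Extendₗ_of_notMem_range (f : L2 α) {b : β} (hb : b ∉ Set.range φ) :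
    l2Extendₗ hφ f b = 0 :=
  Function.extend_apply' _ _ _ hb

theorem norm_l2Compₗ_le (f : L2 β) : ‖l2Compₗ hφ f‖ ≤ ‖f‖ := by
  have h2 : 0 < (2 : ℝ≥0∞).toReal := by simp
  have hs : Summable fun b => ‖f b‖ ^ (2 : ℝ≥0∞).toReal := (lp.memℓp f).summable h2
  rw [lp.norm_eq_tsum_rpow h2, lp.norm_eq_tsum_rpow h2]
  refine Real.rpow_le_rpow (tsum_nonneg fun a => by positivity) ?_ (by positivity)
  exact tsum_comp_le_tsum_of_inj hs (fun b => by positivity) hφ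

theorem norm_l2Extendₗ (f : L2 α) : ‖l2Extendₗ hφ f‖ = ‖f‖ := by
  have h2 : 0 < (2 : ℝ≥0∞).toReal := by simp
  rw [lp.norm_eq_tsum_rpow h2, lp.norm_eq_tsum_rpow h2]
  refine congrArg (· ^ (1 / (2 : ℝ≥0∞).toReal)) ?_
  rw [← hφ.tsum_eq]
  · exact tsum_congr fun a => by rw [l2Extendₗ_apply]
  · intro b hb
    by_contra h
    exact hb (by simp [l2Extendₗ_of_notMem_range hφ f h])

/-- Composition with an injection as a bounded operator. -/
noncomputable def l2Comp : L2 β →L[ℂ] L2 α :=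
  (l2Compₗ hφ).mkContinuous 1 fun f => by simpa using norm_l2Compₗ_le hφ f

/-- Extension by zero as a bounded operator. -/
noncomputable def l2Extend : L2 α →L[ℂ] L2 β :=
  (l2Extendₗ hφ).mkContinuous 1 fun f => by simpa using (norm_l2Extendₗ hφ f).le

theorem norm_l2Comp_le : ‖l2Comp hφ‖ ≤ 1 :=
  LinearMap.mkContinuous_norm_le _ zero_le_one _

theorem norm_l2Extend_le : ‖l2Extend hφ‖ ≤ 1 :=
  LinearMap.mkContinuous_norm_le _ zero_le_one _

theorem l2Comp_apply (f : L2 β) (a : α) : l2Comp hφ f a = f (φ a) := rfl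

theorem l2Extend_apply (f : L2 α) (a : α) : l2Extend hφ f (φ a) = f a :=
  l2Extendₗ_apply hφ f a

theorem l2Extend_of_notMem_range (f : L2 α) {b : β} (hb : b ∉ Set.range φ) :
    l2Extend hφ f b = 0 :=
  l2Extendₗ_of_notMem_range hφ f hb

/-- An extension by zero vanishes off the image of `φ`, so both inner products are the same sum over
`α`. -/
theorem adjoint_l2Comp : ContinuousLinearMap.adjoint (l2Comp hφ) = l2Extend hφ := by
  symm
  rw [ContinuousLinearMap.eq_adjoint_iff]
  intro f g
  rw [lp.inner_eq_tsum, lp.inner_eq_tsum, ← hφ.tsum_eq]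
  · exact tsum_congr fun a => by rw [l2Extend_apply, l2Comp_apply]
  · intro b hb
    by_contra h
    exact hb (by simp [l2Extend_of_notMem_range hφ f h])

theorem adjoint_l2Extend : ContinuousLinearMap.adjoint (l2Extend hφ) = l2Comp hφ := by
  rw [← adjoint_l2Comp, ContinuousLinearMap.adjoint_adjoint]

variable (e : ι × α ≃ β)

theorem prodMk_injective (i : ι) : Function.Injective fun a => e (i, a) :=
  e.injective.comp (Prod.mk_right_injective i)

theorem l2_ext_of_equiv {f g : L2 β} (h : ∀ i a, f (e (i, a)) = g (e (i, a))) : f = g := by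
  refine lp.ext (funext fun b => ?_)
  obtain ⟨⟨i, a⟩, rfl⟩ := e.surjective b
  exact h i a

variable [Fintype ι]

/-- The operator on `ℓ²(β)` that acts as `T` on each of the copies of `ℓ²(α)` given by
`β ≃ ι × α`. -/
noncomputable def amplifyFun (T : L2 α →L[ℂ] L2 α) : L2 β →L[ℂ] L2 β :=
  ∑ i, (l2Extend (prodMk_injective e i)).comp (T.comp (l2Comp (prodMk_injective e i)))

theorem amplifyFun_apply (T : L2 α →L[ℂ] L2 α) (f : L2 β) (i : ι) (a : α) :
    amplifyFun e T f (e (i, a)) = T (l2Comp (prodMk_injective e i) f) a := by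
  classical
  rw [amplifyFun, _root_.sum_apply, lp.coeFn_sum, Finset.sum_apply,
    -- The copies of `α` in `β` are disjoint, so the other summands vanish at `e (i, a)`.
    Finset.sum_eq_single i]
  · exact l2Extend_apply (prodMk_injective e i) _ a
  · intro j _ hj
    refine l2Extend_of_notMem_range (prodMk_injective e j) _ ?_
    rintro ⟨a', h⟩
    exact hj (congrArg Prod.fst (e.injective h))
  · simp

theorem l2Comp_amplifyFun (T : L2 α →L[ℂ] L2 α) (f : L2 β) (i : ι) :
    l2Comp (prodMk_injective e i) (amplifyFun e T f) = T (l2Comp (prodMk_injective e i) f) :=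
  lp.ext (funext fun a => amplifyFun_apply e T f i a)

/-- The amplification `T ↦ T ⊗ 1` as a star homomorphism. -/
noncomputable def amplify : (L2 α →L[ℂ] L2 α) →⋆ₐ[ℂ] (L2 β →L[ℂ] L2 β) where
  toFun := amplifyFun e
  map_one' := ContinuousLinearMap.ext fun f => l2_ext_of_equiv e fun i a =>
    amplifyFun_apply e 1 f i a
  map_mul' S T := ContinuousLinearMap.ext fun f => l2_ext_of_equiv e fun i a => by
    rw [amplifyFun_apply, mul_apply_eq_comp, mul_apply_eq_comp,
      amplifyFun_apply, l2Comp_amplifyFun]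
  map_zero' := by simp [amplifyFun]
  map_add' S T := by simp [amplifyFun, Finset.sum_add_distrib]
  commutes' c := ContinuousLinearMap.ext fun f => l2_ext_of_equiv e fun i a =>
    amplifyFun_apply e (algebraMap ℂ _ c) f i a
  -- Taking adjoints swaps restriction to a copy with extension from it, so each summand keeps its
  -- shape.
  map_star' T := by
    simp only [amplifyFun, ContinuousLinearMap.star_eq_adjoint, map_sum,
      ContinuousLinearMap.adjoint_comp, adjoint_l2Comp, adjoint_l2Extend,
      ContinuousLinearMap.comp_assoc]

theorem amplify_apply (T : L2 α →L[ℂ] L2 α) (f : L2 β) (i : ι) (a : α) :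
    amplify e T f (e (i, a)) = T (l2Comp (prodMk_injective e i) f) a :=
  amplifyFun_apply e T f i a

end Amplification

/-! ### The retract between left regular representations -/

section RegularRetract

variable {G : Type*} [Group G] (M : Subgroup G)

/-- The decomposition of `G` into right cosets of `M`. -/
noncomputable def quotientProdEquiv : (G ⧸ M) × M ≃ G :=
  -- Inverses of left coset representatives represent the right cosets, and left translation by `M`
  -- moves only the `M`-coordinate. Hence the regular representation of `G`, restricted to `M`, is
  -- an amplification of that of `M`.
  Equiv.ofBijective (fun p => p.2 * p.1.out⁻¹) <| by
    constructor
    · rintro ⟨c, m⟩ ⟨c', m'⟩ h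
      have hc : c = c' := by
        rw [← QuotientGroup.out_eq' c, ← QuotientGroup.out_eq' c', QuotientGroup.eq]
        have h' : c.out⁻¹ * c'.out = (m : G)⁻¹ * m' := by
          rw [eq_inv_mul_iff_mul_eq, ← mul_assoc, ← eq_mul_inv_iff_mul_eq]
          exact h
        rw [h']
        exact mul_mem (inv_mem m.2) m'.2
      subst hc
      exact Prod.ext rfl (Subtype.ext (mul_right_cancel h))
    · intro x
      have hx : x * (QuotientGroup.mk x⁻¹ : G ⧸ M).out ∈ M := by
        have h := QuotientGroup.eq.1 (QuotientGroup.out_eq' (QuotientGroup.mk x⁻¹ : G ⧸ M)).symm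
        rwa [inv_inv] at h
      exact ⟨(QuotientGroup.mk x⁻¹, ⟨_, hx⟩), mul_inv_cancel_right _ _⟩

theorem quotientProdEquiv_apply (c : G ⧸ M) (m : M) :
    quotientProdEquiv M (c, m) = m * c.out⁻¹ := rfl

/-- Amplification and compression relate the left regular representations of `M` and `G`. -/
noncomputable def leftRegularRetract [Fintype (G ⧸ M)] :
    SubgroupRetract (leftRegular G) (leftRegular M) where
  incl := amplify (quotientProdEquiv M)
  retract :=
    { toFun := fun T => (l2Comp M.subtype_injective).comp (T.comp (l2Extend M.subtype_injective))
      map_add' := fun S T => by simp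
      map_smul' := fun c T => by simp }
  incl_apply m := ContinuousLinearMap.ext fun f => l2_ext_of_equiv (quotientProdEquiv M) fun c a => by
    rw [amplify_apply, leftRegular_apply, leftRegular_apply, l2Comp_apply,
      quotientProdEquiv_apply, quotientProdEquiv_apply, Subgroup.coe_mul, Subgroup.coe_inv,
      mul_assoc]
  retract_mem m := ContinuousLinearMap.ext fun f => lp.ext <| funext fun a =>
    l2Extend_apply M.subtype_injective f (m⁻¹ * a)
  retract_notMem g hg := ContinuousLinearMap.ext fun f => lp.ext <| funext fun a => by
    -- The value at `a ∈ M` is that of the extended function at `g⁻¹ a`, which is outside `M` when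
    -- `g` is.
    refine l2Extend_of_notMem_range M.subtype_injective f ?_
    rintro ⟨b, hb⟩
    refine hg ?_
    have h : g = a * (b : G)⁻¹ := by
      rw [eq_mul_inv_iff_mul_eq, ← eq_inv_mul_iff_mul_eq]
      exact hb
    rw [h]
    exact mul_mem a.2 (inv_mem b.2)
  norm_retract_le T := by
    change ‖(l2Comp M.subtype_injective).comp (T.comp (l2Extend M.subtype_injective))‖ ≤ ‖T‖
    calc _ ≤ ‖l2Comp M.subtype_injective‖ * (‖T‖ * ‖l2Extend M.subtype_injective‖) :=
        (ContinuousLinearMap.opNorm_comp_le _ _).trans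
          (mul_le_mul_of_nonneg_left (ContinuousLinearMap.opNorm_comp_le _ _) (norm_nonneg _))
      _ ≤ 1 * (‖T‖ * 1) := by
        gcongr
        exacts [norm_l2Comp_le _, norm_l2Extend_le _]
      _ = ‖T‖ := by ring

end RegularRetract

/-! ### The cocycle of a coset section -/

section CosetSection

variable {G : Type*} [Group G] (M : Subgroup G)

open Classical in
/-- A section of `G → G ⧸ M` that sends the trivial coset to `1`. -/
noncomputable def cosetSection (x : G ⧸ M) : G :=
  if x = (1 : G) then 1 else x.out

theorem mk_cosetSection (x : G ⧸ M) : QuotientGroup.mk (cosetSection M x) = x := by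
  rw [cosetSection]
  split_ifs with h
  · exact h.symm
  · exact QuotientGroup.out_eq' x

theorem cosetSection_one : cosetSection M ((1 : G) : G ⧸ M) = 1 := if_pos rfl

/-- The cocycle `(g, x) ↦ s(x)⁻¹ g s(g⁻¹ x)` of a section `s` of `G → G ⧸ M`. -/
noncomputable def cosetCocycle (g : G) (x : G ⧸ M) : M :=
  ⟨(cosetSection M x)⁻¹ * (g * cosetSection M (g⁻¹ • x)), by
    rw [← QuotientGroup.eq, mk_cosetSection]
    have h := congrArg (g • ·) (mk_cosetSection M (g⁻¹ • x))
    exact ((h.trans (smul_inv_smul g x)).symm)⟩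

theorem cosetCocycle_one (x : G ⧸ M) : cosetCocycle M 1 x = 1 :=
  Subtype.ext (by simp [cosetCocycle])

/-- This cocycle identity is what makes the induced action multiplicative. -/
theorem cosetCocycle_mul (g h : G) (x : G ⧸ M) :
    cosetCocycle M (g * h) x = cosetCocycle M g x * cosetCocycle M h (g⁻¹ • x) :=
  Subtype.ext (by simp [cosetCocycle, mul_assoc, mul_smul])

/-- The normalisation of the section at the trivial coset matters here: otherwise a conjugate of `m`
would appear, and compression would return a conjugated representation instead of `σ` itself. -/
theorem cosetCocycle_of_mem (m : M) : cosetCocycle M (m : G) ((1 : G) : G ⧸ M) = m := by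
  have h : (m : G)⁻¹ • ((1 : G) : G ⧸ M) = ((1 : G) : G ⧸ M) := by
    rw [MulAction.Quotient.smul_coe, QuotientGroup.eq]
    simp
  exact Subtype.ext (by simp only [cosetCocycle, h, cosetSection_one]; simp)

end CosetSection

/-! ### Restriction, induction and the universal retract -/

namespace UnitaryRep

universe u

variable {G : Type u} [Group G] {M : Subgroup G}

/-- Restriction of a unitary representation to a subgroup. -/
noncomputable def restrict (ρ : UnitaryRep G) (M : Subgroup G) : UnitaryRep M where
  space := ρ.space
  rep := ρ.rep.comp M.subtype

/-- The action of `g` on the space of the induced representation. -/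
noncomputable def inducedIsometry [Fintype (G ⧸ M)] (σ : UnitaryRep M) (g : G) :
    (PiLp 2 fun _ : G ⧸ M => σ.space) ≃ₗᵢ[ℂ] PiLp 2 fun _ : G ⧸ M => σ.space :=
  (LinearIsometryEquiv.piLpCongrLeft 2 ℂ σ.space (MulAction.toPerm g)).trans
    (LinearIsometryEquiv.piLpCongrRight 2 fun x =>
      Unitary.linearIsometryEquiv (σ.rep (cosetCocycle M g x)))

theorem inducedIsometry_apply [Fintype (G ⧸ M)] (σ : UnitaryRep M) (g : G)
    (f : PiLp 2 fun _ : G ⧸ M => σ.space) (x : G ⧸ M) :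
    σ.inducedIsometry g f x =
      (σ.rep (cosetCocycle M g x) : σ.space →L[ℂ] σ.space) (f (g⁻¹ • x)) := rfl

/-- The unitary representation of `G` induced by a unitary representation of a subgroup of finite
index. -/
noncomputable def induced [Fintype (G ⧸ M)] (σ : UnitaryRep M) : UnitaryRep G where
  space := PiLp 2 fun _ : G ⧸ M => σ.space
  rep := (Unitary.linearIsometryEquiv (𝕜 := ℂ)).symm.toMonoidHom.comp
    { toFun := σ.inducedIsometry
      map_one' := by
        ext f x
        rw [inducedIsometry_apply, cosetCocycle_one, map_one, inv_one, one_smul]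
        rfl
      map_mul' := fun g h => by
        ext f x
        rw [inducedIsometry_apply, cosetCocycle_mul, coe_unitary_mul, mul_inv_rev, mul_smul]
        rfl }

open Classical in
/-- The inclusion of the space of `σ` in the space of the induced representation, as the vectors
supported at the trivial coset. -/
noncomputable def toInduced [Fintype (G ⧸ M)] (σ : UnitaryRep M) :
    σ.space →L[ℂ] PiLp 2 fun _ : G ⧸ M => σ.space :=
  ((WithLp.linearEquiv 2 ℂ (G ⧸ M → σ.space)).symm.toLinearMap.comp
    (LinearMap.single ℂ (fun _ : G ⧸ M => σ.space) ((1 : G) : G ⧸ M))).mkContinuous 1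
    fun v => by rw [one_mul]; exact (PiLp.norm_single 2 (fun _ : G ⧸ M => σ.space) _ v).le

/-- Evaluation at the trivial coset. -/
noncomputable def ofInduced [Fintype (G ⧸ M)] (σ : UnitaryRep M) :
    (PiLp 2 fun _ : G ⧸ M => σ.space) →L[ℂ] σ.space :=
  (PiLp.projₗ 2 (fun _ : G ⧸ M => σ.space) ((1 : G) : G ⧸ M)).mkContinuous 1
    fun f => by rw [one_mul]; exact PiLp.norm_apply_le f _

theorem norm_toInduced_le [Fintype (G ⧸ M)] (σ : UnitaryRep M) : ‖σ.toInduced‖ ≤ 1 :=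
  LinearMap.mkContinuous_norm_le _ zero_le_one _

theorem norm_ofInduced_le [Fintype (G ⧸ M)] (σ : UnitaryRep M) : ‖σ.ofInduced‖ ≤ 1 :=
  LinearMap.mkContinuous_norm_le _ zero_le_one _

/-- The compression of an operator on the space of the induced representation. -/
noncomputable def compress [Fintype (G ⧸ M)] (σ : UnitaryRep M)
    (T : (PiLp 2 fun _ : G ⧸ M => σ.space) →L[ℂ] PiLp 2 fun _ : G ⧸ M => σ.space) :
    σ.space →L[ℂ] σ.space :=
  σ.ofInduced.comp (T.comp σ.toInduced)

theorem norm_compress_le [Fintype (G ⧸ M)] (σ : UnitaryRep M)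
    (T : (PiLp 2 fun _ : G ⧸ M => σ.space) →L[ℂ] PiLp 2 fun _ : G ⧸ M => σ.space) :
    ‖σ.compress T‖ ≤ ‖T‖ :=
  calc _ ≤ ‖σ.ofInduced‖ * (‖T‖ * ‖σ.toInduced‖) :=
        (ContinuousLinearMap.opNorm_comp_le _ _).trans
          (mul_le_mul_of_nonneg_left (ContinuousLinearMap.opNorm_comp_le _ _) (norm_nonneg _))
    _ ≤ 1 * (‖T‖ * 1) := by
      gcongr
      exacts [σ.norm_ofInduced_le, σ.norm_toInduced_le]
    _ = ‖T‖ := by ring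

-- This is the diagonal entry of the induced operator at the trivial coset; it sees the vector only
-- if `g⁻¹` fixes that coset, that is, if `g ∈ M`.
open Classical in
theorem compress_induced_rep_apply [Fintype (G ⧸ M)] (σ : UnitaryRep M) (g : G) (v : σ.space) :
    σ.compress (σ.induced.rep g : σ.induced.space →L[ℂ] σ.induced.space) v =
      (σ.rep (cosetCocycle M g ((1 : G) : G ⧸ M)) : σ.space →L[ℂ] σ.space)
        ((PiLp.single 2 ((1 : G) : G ⧸ M) v : PiLp 2 fun _ : G ⧸ M => σ.space)
          (g⁻¹ • ((1 : G) : G ⧸ M))) := rfl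

theorem inv_smul_one_eq_iff (M : Subgroup G) (g : G) :
    g⁻¹ • ((1 : G) : G ⧸ M) = ((1 : G) : G ⧸ M) ↔ g ∈ M := by
  rw [MulAction.Quotient.smul_coe, QuotientGroup.eq]
  simp

theorem compress_induced_rep_mem [Fintype (G ⧸ M)] (σ : UnitaryRep M) (m : M) :
    σ.compress (σ.induced.rep (m : G) : σ.induced.space →L[ℂ] σ.induced.space) = σ.rep m := by
  classical
  ext v
  rw [compress_induced_rep_apply, (inv_smul_one_eq_iff M _).2 m.2, cosetCocycle_of_mem,
    PiLp.single_eq_same]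

theorem compress_induced_rep_notMem [Fintype (G ⧸ M)] (σ : UnitaryRep M) {g : G} (hg : g ∉ M) :
    σ.compress (σ.induced.rep g : σ.induced.space →L[ℂ] σ.induced.space) = 0 := by
  classical
  ext v
  rw [compress_induced_rep_apply, PiLp.single_eq_of_ne 2 (mt (inv_smul_one_eq_iff M g).1 hg),
    map_zero]
  rfl

/-- Restriction and induction of representations relate the universal families of `M` and `G`. -/
noncomputable def univRetract (M : Subgroup G) [Fintype (G ⧸ M)] :
    SubgroupRetract (univ G) (univ M) where
  -- The component at `ρ` is the component of the family at the restriction of `ρ`; all operations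
  -- are componentwise.
  incl :=
    { toFun := fun T => ⟨fun ρ => T (ρ.restrict M), memℓp_infty ⟨‖T‖, by
        rintro _ ⟨ρ, rfl⟩
        exact lp.norm_apply_le_norm ENNReal.top_ne_zero T (ρ.restrict M)⟩⟩
      map_one' := rfl
      map_mul' := fun _ _ => rfl
      map_zero' := rfl
      map_add' := fun _ _ => rfl
      commutes' := fun _ => rfl
      map_star' := fun _ => rfl }
  -- The induced representation lives in the same universe, so it is an index of the families over
  -- `G`, and its component can be compressed to the space of `σ`.
  retract :=
    { toFun := fun T => ⟨fun σ => σ.compress (T σ.induced), memℓp_infty ⟨‖T‖, by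
        rintro _ ⟨σ, rfl⟩
        exact (σ.norm_compress_le _).trans
          (lp.norm_apply_le_norm ENNReal.top_ne_zero T σ.induced)⟩⟩
      map_add' := fun S T => lp.ext <| funext fun σ => ContinuousLinearMap.ext fun v =>
        map_add σ.ofInduced (S σ.induced (σ.toInduced v)) (T σ.induced (σ.toInduced v))
      map_smul' := fun c T => lp.ext <| funext fun σ => ContinuousLinearMap.ext fun v =>
        map_smul σ.ofInduced c (T σ.induced (σ.toInduced v)) }
  incl_apply m := rfl
  retract_mem m := lp.ext <| funext fun σ => σ.compress_induced_rep_mem m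
  retract_notMem g hg := lp.ext <| funext fun σ => σ.compress_induced_rep_notMem hg
  norm_retract_le T := lp.norm_le_of_forall_le (norm_nonneg T) fun σ =>
    (σ.norm_compress_le _).trans (lp.norm_apply_le_norm ENNReal.top_ne_zero T σ.induced)

end UnitaryRep

/-! ### Nontriviality and the two group C*-algebras -/

instance {G : Type*} [Group G] : Nontrivial (L2 G) := by
  classical
  refine ⟨⟨lp.single 2 (1 : G) (1 : ℂ), 0, fun h => ?_⟩⟩
  have h1 := congrArg (fun f : L2 G => f 1) h
  simp at h1

instance {G : Type*} [Group G] : Nontrivial (ReducedGroupCStar G) := by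
  refine ⟨⟨1, 0, fun h => ?_⟩⟩
  have h1 : (1 : L2 G →L[ℂ] L2 G) = 0 := congrArg ReducedGroupCStar.incl h
  exact one_ne_zero h1

instance {G : Type*} [Group G] : Nontrivial (GroupCStar G) := by
  refine ⟨⟨1, 0, fun h => ?_⟩⟩
  have h1 : (1 : UnitaryRep.BoundedFamilies G) = 0 := congrArg GroupCStar.incl h
  -- The component at the left regular representation witnesses that the algebra is not zero.
  have h2 : (1 : L2 G →L[ℂ] L2 G) = 0 :=
    congrArg (fun T : UnitaryRep.BoundedFamilies G => T ⟨L2 G, leftRegular G⟩) h1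
  exact one_ne_zero h2

theorem mainTheorem6 {G : Type*} [Group G] [Countable G] (H K L : Subgroup G)
    (hHK : H ≤ K) (hHL : H ≤ L) (hK : H ≠ K) (hL : H ≠ L) (hfin : H.FiniteIndex) :
    -- reduced group C*-algebras
    (∃ (ιH : ReducedGroupCStar H →⋆ₐ[ℂ] ReducedGroupCStar G)
        (ιK : ReducedGroupCStar K →⋆ₐ[ℂ] ReducedGroupCStar G)
        (ιL : ReducedGroupCStar L →⋆ₐ[ℂ] ReducedGroupCStar G),
      -- the canonical embeddings
      (Function.Injective ιH ∧ ∀ h : H, ιH (.of h) = .of (h : G)) ∧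
      (Function.Injective ιK ∧ ∀ k : K, ιK (.of k) = .of (k : G)) ∧
      (Function.Injective ιL ∧ ∀ l : L, ιL (.of l) = .of (l : G)) ∧
      IsClosed (ιH.range : Set (ReducedGroupCStar G)) ∧
      ιK.range ≠ ιH.range ∧ ιL.range ≠ ιH.range ∧
      -- the canonical conditional expectation
      ∃ E : CondExp ιH.range,
        (∀ g : G, g ∈ H → E (.of g) = .of g) ∧ (∀ g : G, g ∉ H → E (.of g) = 0) ∧
        ∃ (hE : E.FiniteIndex) (hC : ιK.range ∈ E.IMS) (hD : ιL.range ∈ E.IMS),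
          Real.cos (E.interiorAngle hE hC hD) =
            ((H.relIndex (K ⊓ L) : ℝ) - 1) /
              (√((H.relIndex K : ℝ) - 1) * √((H.relIndex L : ℝ) - 1))) ∧
    -- universal group C*-algebras
    (∃ (ιH : GroupCStar H →⋆ₐ[ℂ] GroupCStar G)
        (ιK : GroupCStar K →⋆ₐ[ℂ] GroupCStar G)
        (ιL : GroupCStar L →⋆ₐ[ℂ] GroupCStar G),
      (Function.Injective ιH ∧ ∀ h : H, ιH (.of h) = .of (h : G)) ∧
      (Function.Injective ιK ∧ ∀ k : K, ιK (.of k) = .of (k : G)) ∧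
      (Function.Injective ιL ∧ ∀ l : L, ιL (.of l) = .of (l : G)) ∧
      IsClosed (ιH.range : Set (GroupCStar G)) ∧
      ιK.range ≠ ιH.range ∧ ιL.range ≠ ιH.range ∧
      ∃ E : CondExp ιH.range,
        (∀ g : G, g ∈ H → E (.of g) = .of g) ∧ (∀ g : G, g ∉ H → E (.of g) = 0) ∧
        ∃ (hE : E.FiniteIndex) (hC : ιK.range ∈ E.IMS) (hD : ιL.range ∈ E.IMS),
          Real.cos (E.interiorAngle hE hC hD) =
            ((H.relIndex (K ⊓ L) : ℝ) - 1) /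
              (√((H.relIndex K : ℝ) - 1) * √((H.relIndex L : ℝ) - 1))) := by
  have : K.FiniteIndex := Subgroup.finiteIndex_of_le hHK
  have : L.FiniteIndex := Subgroup.finiteIndex_of_le hHL
  have := Fintype.ofFinite (G ⧸ H)
  have := Fintype.ofFinite (G ⧸ K)
  have := Fintype.ofFinite (G ⧸ L)
  constructor
  · have : Nontrivial (generatedCStar (leftRegular G)) :=
      inferInstanceAs (Nontrivial (ReducedGroupCStar G))
    -- The group C*-algebras and their canonical unitaries unfold to `generatedCStar` and
    -- `generatedHom`, so the abstract statement applies definitionally.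
    exact exists_cos_interiorAngle_eq hHK hHL hK hL hfin (dense_span_generatedHom (leftRegular G))
      (dense_span_generatedHom (leftRegular H)) (dense_span_generatedHom (leftRegular K))
      (dense_span_generatedHom (leftRegular L)) (leftRegularRetract H).generated
      (leftRegularRetract K).generated (leftRegularRetract L).generated
  · have : Nontrivial (generatedCStar (UnitaryRep.univ G)) :=
      inferInstanceAs (Nontrivial (GroupCStar G))
    exact exists_cos_interiorAngle_eq hHK hHL hK hL hfin
      (dense_span_generatedHom (UnitaryRep.univ G)) (dense_span_generatedHom (UnitaryRep.univ H))
      (dense_span_generatedHom (UnitaryRep.univ K)) (dense_span_generatedHom (UnitaryRep.univ L))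
      (UnitaryRep.univRetract H).generated (UnitaryRep.univRetract K).generated
      (UnitaryRep.univRetract L).generated
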